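/- Let $m\ge 1$, $k\ge 0$ be integers, $n=m+k$, $\beta>0$, and let $\mathbb T^d=\mathbb R^d/\mathbb Z^d$ with its Lebesgue measure $\lambda$ of total mass $1$. Write points of $\mathbb T^n$ as $(x,y)$ with $x\in\mathbb T^m$, $y\in\mathbb T^{k}$. Let $\mathcal F=(\mathcal F_1,\mathcal F_2)\in\mathcal C^1(\mathbb T^n,\mathbb R^m\times\mathbb R^{k})$ be a (not necessarily conservative) force field. For a probability density $\pi_t$ on $\mathbb T^n$ let $$\pi_t^\xi(x)=\int_{\mathbb T^{k}}\pi_t(x,y)\,dy,\qquad G_t(x)=-\int_{\mathbb T^{k}}\mathcal F_1(x,y)\,\frac{\pi_t(x,y)}{\pi_t^\xi(x)}\,dy .$$ Let $(\pi_t,B_t)_{t\ge 0}$ be a solution of the nonlinear Fokker–Planck equation $$\partial_t\pi_t=\beta^{-1}\Delta\pi_t-\nabla\cdot(\mathcal F\pi_t)-\nabla_x\cdot(B_t\pi_t),$$ where either $B_t=G_t$ (ABF algorithm), or $B_t=\mathsf P_{L^2(\lambda)}(G_t)=\nabla H_t$ (PABF algorithm), $H_t$ being a minimizer of $g\mapsto\int_{\mathbb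 T^m}|G_t-\nabla g|^2\,dx$ over the functions $g\in H^1(\mathbb T^m)$ with $\int_{\mathbb T^m} g\,dx=0$. Here a solution means that each $\pi_t$, $t\ge0$, is a probability density, that $(t,z)\mapsto\pi_t(z)$ is continuous on $[0,\infty)\times\mathbb T^n$ and of class $\mathcal C^1$ on $(0,\infty)\times\mathbb T^n$, and that for every $\varphi\in\mathcal C^1(\mathbb T^n)$ and $t>0$ $$\frac{d}{dt}\int_{\mathbb T^n}\varphi\,\pi_t\,dz=\int_{\mathbb T^n}\bigl(-\beta^{-1}\nabla\pi_t+\mathcal F\pi_t+(B_t,0)\,\pi_t\bigr)\cdot\nabla\varphi\,dz .$$ Assume that $\pi_0$ is of class $\mathcal C^\infty$ and that $\pi_0^\xi>0$ everywhere on $\mathbb T^m$. Then, for both algorithms, there is a constant $C>0$, depending only on $m$ and $\beta$ (in particular not on the initial distribution), such that for all $t\ge 1$ $$\|\pi_t^\xi-1\|_{L^\infty(\mathbb T^m)}\le C\,e^{-4\beta^{-1}\pi^2t}\,\|\pi_0^\xi-1\|_{L^2(\mathbb T^m)} ,$$ where $\pi$ in the exponent is the number $3.14159\ldots$ -/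

import Mathlib

open MeasureTheory Set
open scoped ContDiff

namespace AdaptiveBiasing

noncomputable section

/-- The quotient map `ℝ^ι → 𝕋^ι = ℝ^ι / ℤ^ι`. -/
def torusMk {ι : Type*} (x : ι → ℝ) : UnitAddTorus ι := fun i => (x i : UnitAddCircle)

/-- A function on the torus is of class `C^r` when its periodic lift to `ℝ^ι` is. -/
def TorusContDiff {ι E : Type*} [Fintype ι] [NormedAddCommGroup E] [NormedSpace ℝ E]
    (r : WithTop ℕ∞) (f : UnitAddTorus ι → E) : Prop :=
  ContDiff ℝ r (fun x : ι → ℝ => f (torusMk x))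

/-- The partial derivative `∂_i f` of a real function on the torus. -/
def pd {ι : Type*} [DecidableEq ι] (i : ι) (f : UnitAddTorus ι → ℝ) (x : UnitAddTorus ι) : ℝ :=
  deriv (fun s : ℝ => f (x + Pi.single i (s : UnitAddCircle))) 0

/-- `g` belongs to `H¹(𝕋^ι)` and `v` is (a version of) its weak gradient. -/
structure HasWeakGradient {ι : Type*} [Fintype ι] [DecidableEq ι]
    (g : UnitAddTorus ι → ℝ) (v : UnitAddTorus ι → ι → ℝ) : Prop where
  memLp : MemLp g 2 volume
  grad_memLp : ∀ i, MemLp (fun x => v x i) 2 volume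
  integral_eq : ∀ φ : UnitAddTorus ι → ℝ, TorusContDiff ∞ φ → ∀ i,
    ∫ x, g x * pd i φ x = -∫ x, v x i * φ x

/-- `b` is (a version of) the Helmholtz projection `P_{L²(λ)}(f)` of the vector field `f`: the
weak gradient of a minimizer of `g ↦ ∫ |f - ∇g|²` over the mean-zero functions of `H¹`. -/
def IsHelmholtzProjection {ι : Type*} [Fintype ι] [DecidableEq ι]
    (f b : UnitAddTorus ι → ι → ℝ) : Prop :=
  ∃ H : UnitAddTorus ι → ℝ, HasWeakGradient H b ∧ ∫ x, H x = 0 ∧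
    ∀ (g : UnitAddTorus ι → ℝ) (v : UnitAddTorus ι → ι → ℝ),
      HasWeakGradient g v → ∫ x, g x = 0 →
        ∫ x, ∑ i, (f x i - b x i) ^ 2 ≤ ∫ x, ∑ i, (f x i - v x i) ^ 2

/-- The point `(x, y)` of `𝕋^(m+k) = 𝕋^m × 𝕋^k`. -/
def join {m k : ℕ} (x : UnitAddTorus (Fin m)) (y : UnitAddTorus (Fin k)) :
    UnitAddTorus (Fin m ⊕ Fin k) := Sum.elim x y

/-- The transition coordinate `ξ(x, y) = x`. -/
def xi {m k : ℕ} (z : UnitAddTorus (Fin m ⊕ Fin k)) : UnitAddTorus (Fin m) :=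
  fun i => z (Sum.inl i)

/-- The marginal density `ρ^ξ(x) = ∫ ρ(x, y) dy`. -/
def marginal {m k : ℕ} (ρ : UnitAddTorus (Fin m ⊕ Fin k) → ℝ) (x : UnitAddTorus (Fin m)) : ℝ :=
  ∫ y : UnitAddTorus (Fin k), ρ (join x y)

/-- The average mean force `G(x) = ∫ -F₁(x, y) ρ(x, y) / ρ^ξ(x) dy`. -/
def meanForce {m k : ℕ} (F : UnitAddTorus (Fin m ⊕ Fin k) → Fin m ⊕ Fin k → ℝ)
    (ρ : UnitAddTorus (Fin m ⊕ Fin k) → ℝ) (x : UnitAddTorus (Fin m)) : Fin m → ℝ :=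
  fun i => ∫ y : UnitAddTorus (Fin k), -F (join x y) (Sum.inl i) * (ρ (join x y) / marginal ρ x)

/-- The two algorithms: adaptive biasing force, and its projected variant. -/
inductive Algorithm
  | ABF
  | PABF

/-- `b` is the bias that the algorithm builds from the average mean force `G`. -/
def Algorithm.IsBias {m : ℕ} (a : Algorithm) (G b : UnitAddTorus (Fin m) → Fin m → ℝ) : Prop :=
  match a with
  | .ABF => b = G
  | .PABF => IsHelmholtzProjection G b

/-- The total drift `F(x, y) + (b(x), 0)`. -/
def drift {m k : ℕ} (F : UnitAddTorus (Fin m ⊕ Fin k) → Fin m ⊕ Fin k → ℝ)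
    (b : UnitAddTorus (Fin m) → Fin m → ℝ) (z : UnitAddTorus (Fin m ⊕ Fin k)) :
    Fin m ⊕ Fin k → ℝ :=
  fun j => F z j + Sum.elim (b (xi z)) 0 j

/-- `(π, B)` solves the nonlinear Fokker-Planck equation
`∂_t π_t = β⁻¹ Δ π_t - ∇ · (F π_t) - ∇_x · (B_t π_t)`, with `B_t` the bias of the algorithm.
The densities `π_t` are continuous up to time `0` and `C¹` in `(t, z)` for positive times, and
the equation holds in divergence form against test functions on the torus. -/
structure IsSolution {m k : ℕ} (a : Algorithm) (β : ℝ)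
    (F : UnitAddTorus (Fin m ⊕ Fin k) → Fin m ⊕ Fin k → ℝ)
    (π : ℝ → UnitAddTorus (Fin m ⊕ Fin k) → ℝ)
    (B : ℝ → UnitAddTorus (Fin m) → Fin m → ℝ) : Prop where
  nonneg : ∀ t, 0 ≤ t → ∀ z, 0 ≤ π t z
  integral_eq_one : ∀ t, 0 ≤ t → ∫ z, π t z = 1
  continuousOn : ContinuousOn (fun q : ℝ × UnitAddTorus (Fin m ⊕ Fin k) => π q.1 q.2)
    (Ici 0 ×ˢ univ)
  contDiffOn : ContDiffOn ℝ 1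
    (fun q : ℝ × (Fin m ⊕ Fin k → ℝ) => π q.1 (torusMk q.2)) (Ioi 0 ×ˢ univ)
  isBias : ∀ t, 0 ≤ t → a.IsBias (meanForce F (π t)) (B t)
  hasDerivAt : ∀ φ : UnitAddTorus (Fin m ⊕ Fin k) → ℝ, TorusContDiff 1 φ → ∀ t, 0 < t →
    HasDerivAt (fun s => ∫ z, φ z * π s z)
      (∫ z, ∑ j, (-(β⁻¹ * pd j (π t) z) + drift F (B t) z j * π t z) * pd j φ z) t

end

end AdaptiveBiasing

/-! Write $u_t=\pi_t^\xi$. Testing the equation against functions of $x$ alone removes the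
$y$-derivatives, and integrating $\mathcal F_1\pi_t$ over $y$ gives $-G_tu_t$. So $u$ solves weakly
$\partial_tu=\beta^{-1}\Delta u-\nabla\cdot((B_t-G_t)u)$ (`integral_mul_deriv_marginal`). The field
$B_t-G_t$ is zero for ABF and orthogonal to all gradients for PABF, by the Euler–Lagrange equation
of the projection. In the derivative of $\int(u-1)^{2p+2}$ it is paired with the gradient of a
polynomial in $u$, hence contributes nothing: every even moment of $u-1$ is dissipated at least at
rate $2\beta^{-1}\int|\nabla(u-1)^{p+1}|^2$ (`hasDerivAt_integral_pow`). This is all that is kept of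
the dynamics, in the structure `IsDissipative`.

Two consequences are combined. For $p=0$ the Poincaré inequality with sharp constant $4\pi^2$ gives
$\|u_t-1\|_2\le e^{-4\pi^2\beta^{-1}t}\|u_0-1\|_2$ (`integral_sq_le_exp`). For $p+1=2^{j+1}$ a Nash
inequality bounds each moment by the square of the preceding one after a short time; iterating over
times that sum to at most $1$ (Moser) gives $\|u_{t+1}-1\|_\infty\le\sqrt Q\,\|u_t-1\|_2$, with $Q$
depending only on $m$ and $\beta$ (`exists_forall_isDissipative_sq_le`). Decay up to $t-1$ followed
by smoothing on $[t-1,t]$ is the theorem. -/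

namespace AdaptiveBiasing

noncomputable section

/-! ### Calculus on the torus through periodic lifts. -/

section TorusCalculus

variable {ι : Type*}

/-- Continuity descends from lifts to the torus along this map. Openness matters because open
quotient maps are stable under products, which is needed when time is an extra variable. -/
theorem isOpenQuotientMap_torusMk : IsOpenQuotientMap (torusMk : (ι → ℝ) → UnitAddTorus ι) :=
  IsOpenQuotientMap.piMap (fun _ => QuotientAddGroup.isOpenQuotientMap_mk)

theorem torusMk_add_single [DecidableEq ι] (x : ι → ℝ) (i : ι) (s : ℝ) :
    torusMk (x + s • Pi.single i 1) = torusMk x + Pi.single i (s : UnitAddCircle) := by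
  ext j
  by_cases h : j = i
  · subst h; simp [torusMk]
  · simp [torusMk, h]

variable [Fintype ι]

instance : IsProbabilityMeasure (volume : Measure UnitAddCircle) :=
  ⟨by simp [AddCircle.measure_univ]⟩

instance : IsProbabilityMeasure (volume : Measure (UnitAddTorus ι)) :=
  inferInstanceAs (IsProbabilityMeasure (Measure.pi fun _ => volume))

instance : (volume : Measure (UnitAddTorus ι)).IsAddHaarMeasure :=
  inferInstanceAs (Measure.IsAddHaarMeasure (Measure.pi fun _ => volume))

theorem integrable_of_continuous {E : Type*} [NormedAddCommGroup E]
    {f : UnitAddTorus ι → E} (hf : Continuous f) : Integrable f volume :=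
  hf.integrable_of_hasCompactSupport (HasCompactSupport.of_compactSpace f)

theorem memLp_of_continuous {E : Type*} [NormedAddCommGroup E]
    {f : UnitAddTorus ι → E} (hf : Continuous f) (p : ENNReal) : MemLp f p volume :=
  hf.memLp_of_hasCompactSupport (HasCompactSupport.of_compactSpace f)

variable {E : Type*} [NormedAddCommGroup E] [NormedSpace ℝ E]

theorem TorusContDiff.continuous {r : WithTop ℕ∞} {f : UnitAddTorus ι → E}
    (hf : TorusContDiff r f) : Continuous f :=
  isOpenQuotientMap_torusMk.continuous_comp_iff.1 (ContDiff.continuous hf)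

variable [DecidableEq ι]

theorem TorusContDiff.hasDerivAt_lift {f : UnitAddTorus ι → E} (hf : TorusContDiff 1 f) (i : ι)
    (x : ι → ℝ) : HasDerivAt (fun s : ℝ => f (torusMk x + Pi.single i (s : UnitAddCircle)))
      (fderiv ℝ (fun x => f (torusMk x)) x (Pi.single i 1)) 0 := by
  have h1 : HasDerivAt (fun s : ℝ => x + s • (Pi.single i 1 : ι → ℝ)) (Pi.single i 1) 0 := by
    simpa using ((hasDerivAt_id (0 : ℝ)).smul_const (Pi.single i 1 : ι → ℝ)).const_add x
  have h2 : HasFDerivAt (fun x => f (torusMk x)) (fderiv ℝ (fun x => f (torusMk x)) x)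
      (x + (0 : ℝ) • (Pi.single i 1 : ι → ℝ)) := by
    simpa using ((ContDiff.differentiable hf one_ne_zero) x).hasFDerivAt
  have h3 := h2.comp_hasDerivAt (0 : ℝ) h1
  simpa [Function.comp_def, torusMk_add_single] using h3

theorem TorusContDiff.pd_torusMk {f : UnitAddTorus ι → ℝ} (hf : TorusContDiff 1 f) (i : ι)
    (x : ι → ℝ) :
    pd i f (torusMk x) = fderiv ℝ (fun x => f (torusMk x)) x (Pi.single i 1) :=
  (hf.hasDerivAt_lift i x).deriv

theorem TorusContDiff.hasDerivAt {f : UnitAddTorus ι → ℝ} (hf : TorusContDiff 1 f) (i : ι)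
    (x : UnitAddTorus ι) :
    HasDerivAt (fun s : ℝ => f (x + Pi.single i (s : UnitAddCircle))) (pd i f x) 0 := by
  obtain ⟨x, rfl⟩ := isOpenQuotientMap_torusMk.surjective x
  rw [hf.pd_torusMk]
  exact hf.hasDerivAt_lift i x

theorem TorusContDiff.continuous_pd {f : UnitAddTorus ι → ℝ} (hf : TorusContDiff 1 f) (i : ι) :
    Continuous (pd i f) := by
  rw [← isOpenQuotientMap_torusMk.continuous_comp_iff]
  have : pd i f ∘ torusMk = fun x => fderiv ℝ (fun x => f (torusMk x)) x (Pi.single i 1) :=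
    funext fun x => hf.pd_torusMk i x
  rw [this]
  exact (ContDiff.continuous_fderiv hf one_ne_zero).clm_apply continuous_const

omit [DecidableEq ι] in
theorem TorusContDiff.comp_left {r : WithTop ℕ∞} {f : UnitAddTorus ι → ℝ}
    (hf : TorusContDiff r f) {g : ℝ → ℝ} (hg : ContDiff ℝ r g) :
    TorusContDiff r (fun x => g (f x)) :=
  ContDiff.comp hg hf

theorem TorusContDiff.pd_comp {f : UnitAddTorus ι → ℝ} (hf : TorusContDiff 1 f) {g : ℝ → ℝ}
    {g' : ℝ} {x : UnitAddTorus ι} (hg : HasDerivAt g g' (f x)) (i : ι) :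
    pd i (fun x => g (f x)) x = g' * pd i f x := by
  have h := hf.hasDerivAt i x
  have hg' : HasDerivAt g g' (f (x + Pi.single i ((0 : ℝ) : UnitAddCircle))) := by simpa using hg
  exact (hg'.comp (0 : ℝ) h).deriv

theorem TorusContDiff.pd_sub_const {f : UnitAddTorus ι → ℝ} (hf : TorusContDiff 1 f) (c : ℝ)
    (i : ι) (x : UnitAddTorus ι) : pd i (fun x => f x - c) x = pd i f x :=
  ((hf.hasDerivAt i x).sub_const c).deriv

omit [Fintype ι] in
theorem hasDerivAt_translate {h h' : UnitAddTorus ι → E} {i : ι}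
    (hd : ∀ x, HasDerivAt (fun s : ℝ => h (x + Pi.single i (s : UnitAddCircle))) (h' x) 0)
    (x : UnitAddTorus ι) (s : ℝ) :
    HasDerivAt (fun s : ℝ => h (x + Pi.single i (s : UnitAddCircle)))
      (h' (x + Pi.single i (s : UnitAddCircle))) s := by
  have h0 := hd (x + Pi.single i (s : UnitAddCircle))
  rw [show (0 : ℝ) = s - s by ring] at h0
  have h2 : HasDerivAt (fun t : ℝ => t - s) 1 s := (hasDerivAt_id s).sub_const s
  have h1 := HasDerivAt.scomp (h := fun t : ℝ => t - s) s h0 h2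
  simp only [one_smul] at h1
  refine h1.congr_of_eventuallyEq (Filter.Eventually.of_forall fun t => ?_)
  simp only [Function.comp, add_assoc, ← Pi.single_add]
  congr 3
  rw [← AddCircle.coe_add]; congr 1; ring

/-- By translation invariance $\int h(x+se_i)\,dx$ does not depend on $s$; differentiate under the
integral at $s=0$. Every integration by parts below comes from this. -/
theorem integral_eq_zero_of_hasDerivAt [CompleteSpace E] {h h' : UnitAddTorus ι → E} {i : ι}
    (hc : Continuous h) (hc' : Continuous h')
    (hd : ∀ x, HasDerivAt (fun s : ℝ => h (x + Pi.single i (s : UnitAddCircle))) (h' x) 0) :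
    ∫ x, h' x = 0 := by
  obtain ⟨C, hC⟩ := (isCompact_univ.bddAbove_image (f := fun x => ‖h' x‖)
    hc'.norm.continuousOn)
  have hcs : ∀ s : ℝ, Continuous fun x : UnitAddTorus ι =>
      h (x + Pi.single i (s : UnitAddCircle)) := fun s => hc.comp (continuous_add_const _)
  have hcs' : Continuous fun x : UnitAddTorus ι =>
      h' (x + Pi.single i ((0 : ℝ) : UnitAddCircle)) := hc'.comp (continuous_add_const _)
  have key := (hasDerivAt_integral_of_dominated_loc_of_deriv_le (μ := volume) (x₀ := (0 : ℝ))
    (s := univ) (bound := fun _ => C)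
    (F := fun (s : ℝ) (x : UnitAddTorus ι) =>
      h (x + (Pi.single i (s : UnitAddCircle) : UnitAddTorus ι)))
    (F' := fun (s : ℝ) (x : UnitAddTorus ι) =>
      h' (x + (Pi.single i (s : UnitAddCircle) : UnitAddTorus ι)))
    Filter.univ_mem (Filter.Eventually.of_forall fun s => (hcs s).aestronglyMeasurable)
    (integrable_of_continuous (hcs 0))
    hcs'.aestronglyMeasurable
    (Filter.Eventually.of_forall fun x s _ => hC ⟨_, mem_univ _, rfl⟩)
    (integrable_const _)
    (Filter.Eventually.of_forall fun x s _ => hasDerivAt_translate hd x s)).2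
  have hconst : (fun s : ℝ => ∫ x : UnitAddTorus ι,
      h (x + (Pi.single i (s : UnitAddCircle) : UnitAddTorus ι))) =
      fun _ => ∫ x, h x := 
    funext fun s => integral_add_right_eq_self h (Pi.single i (s : UnitAddCircle))
  rw [hconst] at key
  have := key.unique (hasDerivAt_const (0 : ℝ) _)
  simpa using this

theorem TorusContDiff.integral_mul_pd {f g : UnitAddTorus ι → ℝ} (hf : TorusContDiff 1 f)
    (hg : TorusContDiff 1 g) (i : ι) : ∫ x, g x * pd i f x = -∫ x, pd i g x * f x := by
  have h := integral_eq_zero_of_hasDerivAt (i := i) (h := fun x => g x * f x)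
    (h' := fun x => pd i g x * f x + g x * pd i f x)
    (hg.continuous.mul hf.continuous)
    (((hg.continuous_pd i).mul hf.continuous).add (hg.continuous.mul (hf.continuous_pd i)))
    (fun x => by simpa using! (hg.hasDerivAt i x).mul (hf.hasDerivAt i x))
  have h1 : Integrable (fun x => pd i g x * f x) volume :=
    integrable_of_continuous ((hg.continuous_pd i).mul hf.continuous)
  have h2 : Integrable (fun x => g x * pd i f x) volume :=
    integrable_of_continuous (hg.continuous.mul (hf.continuous_pd i))
  rw [integral_add h1 h2] at h
  linarith

end TorusCalculus

/-! ### Poincaré and Nash inequalities by Fourier series. -/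

section FourierInequality

open UnitAddTorus

variable {ι : Type*} [Fintype ι]

/-- The Fourier coefficient of a function on the torus. -/
def torusCoeff (f : UnitAddTorus ι → ℂ) (n : ι → ℤ) : ℂ := ∫ x, mFourier (-n) x * f x

theorem volume_unitAddCircle :
    (volume : Measure UnitAddCircle) = AddCircle.haarAddCircle := by
  rw [AddCircle.volume_eq_smul_haarAddCircle]; simp

theorem volume_unitAddTorus : (volume : Measure (UnitAddTorus ι)) =
    Measure.pi fun _ => AddCircle.haarAddCircle := by
  rw [← volume_unitAddCircle]; rfl

theorem hasSum_sq_torusCoeff {f : UnitAddTorus ι → ℂ} (hf : Continuous f) :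
    HasSum (fun n => ‖torusCoeff f n‖ ^ 2) (∫ x, ‖f x‖ ^ 2) := by
  let μ : Measure (UnitAddTorus ι) := Measure.pi fun _ => AddCircle.haarAddCircle
  let g : Lp ℂ 2 μ := ContinuousMap.toLp 2 μ ℂ ⟨f, hf⟩
  have h := hasSum_sq_mFourierCoeff g
  have hg : g =ᵐ[μ] f := ContinuousMap.coeFn_toLp (𝕜 := ℂ) (p := 2) μ ⟨f, hf⟩
  have h1 : ∀ n, torusCoeff f n = mFourierCoeff g n := by
    intro n
    rw [torusCoeff, volume_unitAddTorus]
    refine integral_congr_ae ?_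
    filter_upwards [hg] with x hx
    rw [hx, smul_eq_mul]
  have h2 : ∫ x, ‖f x‖ ^ 2 = ∫ x, ‖g x‖ ^ 2 ∂μ := by
    rw [volume_unitAddTorus]
    refine integral_congr_ae ?_
    filter_upwards [hg] with x hx
    rw [hx]
  simp only [h1, h2]
  exact h

theorem mFourier_add_single [DecidableEq ι] (n : ι → ℤ) (x : UnitAddTorus ι) (i : ι)
    (s : UnitAddCircle) : mFourier n (x + Pi.single i s) = mFourier n x * fourier (n i) s := by
  have h : ∀ y z : UnitAddTorus ι, mFourier n (y + z) = mFourier n y * mFourier n z := by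
    intro y z
    simp [mFourier, Finset.prod_mul_distrib, fourier_apply, AddCircle.toCircle_add]
  rw [h]
  congr 1
  simp only [mFourier, ContinuousMap.coe_mk]
  rw [Finset.prod_eq_single i]
  · simp
  · intro j _ hj; simp [Pi.single_eq_of_ne hj]
  · simp

theorem hasDerivAt_mFourier [DecidableEq ι] (n : ι → ℤ) (x : UnitAddTorus ι) (i : ι) :
    HasDerivAt (fun s : ℝ => mFourier n (x + Pi.single i (s : UnitAddCircle)))
      (2 * Real.pi * Complex.I * n i * mFourier n x) 0 := by
  simp only [mFourier_add_single]
  have h := (hasDerivAt_fourier 1 (n i) 0).const_mul (mFourier n x)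
  convert! h using 1
  simp only [AddCircle.coe_zero, fourier_eval_zero, Complex.ofReal_one]
  ring

theorem norm_mFourier_apply (n : ι → ℤ) (x : UnitAddTorus ι) : ‖mFourier n x‖ = 1 := by
  simp only [mFourier, ContinuousMap.coe_mk, norm_prod, fourier_apply, Circle.norm_coe,
    Finset.prod_const_one]

theorem norm_torusCoeff_le (f : UnitAddTorus ι → ℝ) (n : ι → ℤ) :
    ‖torusCoeff (fun x => (f x : ℂ)) n‖ ≤ ∫ x, |f x| := by
  refine (norm_integral_le_integral_norm _).trans (le_of_eq ?_)
  simp [norm_mFourier_apply]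

variable [DecidableEq ι]

theorem TorusContDiff.torusCoeff_pd {f : UnitAddTorus ι → ℝ} (hf : TorusContDiff 1 f) (i : ι)
    (n : ι → ℤ) : torusCoeff (fun x => (pd i f x : ℂ)) n =
      2 * Real.pi * Complex.I * n i * torusCoeff (fun x => (f x : ℂ)) n := by
  have hf' : Continuous fun x => (f x : ℂ) := Complex.continuous_ofReal.comp hf.continuous
  have hp' : Continuous fun x => (pd i f x : ℂ) :=
    Complex.continuous_ofReal.comp (hf.continuous_pd i)
  have hm : Continuous fun x : UnitAddTorus ι => mFourier (-n) x := (mFourier (-n)).continuous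
  have h := integral_eq_zero_of_hasDerivAt (i := i) (h := fun x => mFourier (-n) x * (f x : ℂ))
    (h' := fun x => (2 * Real.pi * Complex.I * ((-n) i : ℤ) * mFourier (-n) x) * (f x : ℂ)
      + mFourier (-n) x * (pd i f x : ℂ)) (hm.mul hf')
    (((continuous_const.mul hm).mul hf').add (hm.mul hp'))
    (fun x => by
      simpa using! (hasDerivAt_mFourier (-n) x i).mul (hf.hasDerivAt i x).ofReal_comp)
  have h1 : Integrable (fun x => (2 * Real.pi * Complex.I * ((-n) i : ℤ) * mFourier (-n) x)
      * (f x : ℂ)) volume := integrable_of_continuous ((continuous_const.mul hm).mul hf')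
  have h2 : Integrable (fun x => mFourier (-n) x * (pd i f x : ℂ)) volume :=
    integrable_of_continuous (hm.mul hp')
  rw [integral_add h1 h2] at h
  simp only [mul_assoc, integral_const_mul] at h
  simp only [torusCoeff]
  simp only [Pi.neg_apply, Int.cast_neg] at h
  linear_combination h

/-- The dual lattice points of sup norm at most `N`. -/
def latticeBox (ι : Type*) [Fintype ι] [DecidableEq ι] (N : ℕ) : Finset (ι → ℤ) :=
  Fintype.piFinset fun _ => Finset.Icc (-(N : ℤ)) N

theorem card_latticeBox (N : ℕ) : (latticeBox ι N).card = (2 * N + 1) ^ Fintype.card ι := by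
  simp only [latticeBox, Fintype.card_piFinset, Int.card_Icc, Finset.prod_const, Finset.card_univ]
  congr 1
  omega

/-- Parseval, split into low and high frequencies: outside the box some $|n_i|\ge N+1$, so the
symbol $4\pi^2|n|^2$ of the Dirichlet form is at least $4\pi^2(N+1)^2$. -/
theorem TorusContDiff.integral_sq_le {f : UnitAddTorus ι → ℝ} (hf : TorusContDiff 1 f) (N : ℕ) :
    ∫ x, f x ^ 2 ≤ ∑ n ∈ latticeBox ι N, ‖torusCoeff (fun x => (f x : ℂ)) n‖ ^ 2
      + (4 * Real.pi ^ 2 * (N + 1) ^ 2)⁻¹ * ∑ i, ∫ x, pd i f x ^ 2 := by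
  set c := torusCoeff (fun x => (f x : ℂ)) with hc
  have h0 := hasSum_sq_torusCoeff (Complex.continuous_ofReal.comp hf.continuous)
  have hi : ∀ i, HasSum (fun n : ι → ℤ => (2 * Real.pi * n i) ^ 2 * ‖c n‖ ^ 2)
      (∫ x, pd i f x ^ 2) := by
    intro i
    have h := hasSum_sq_torusCoeff (Complex.continuous_ofReal.comp (hf.continuous_pd i))
    simp only [Function.comp_def, hf.torusCoeff_pd, Complex.norm_real, norm_mul, mul_pow] at h
    simpa [mul_pow] using h
  simp only [Function.comp_def, Complex.norm_real, Real.norm_eq_abs, sq_abs] at h0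
  have h1 := (hasSum_sum (s := Finset.univ) fun i _ => hi i).mul_left
    (4 * Real.pi ^ 2 * ((N : ℝ) + 1) ^ 2)⁻¹
  have h2 : HasSum (fun n => if n ∈ latticeBox ι N then ‖c n‖ ^ 2 else 0)
      (∑ n ∈ latticeBox ι N, ‖c n‖ ^ 2) := by
    have := hasSum_sum_of_ne_finset_zero (L := .unconditional _) (s := latticeBox ι N)
      (f := fun n => if n ∈ latticeBox ι N then ‖c n‖ ^ 2 else 0) (by intro n hn; simp [hn])
    rwa [Finset.sum_congr rfl fun n hn => if_pos hn] at this
  refine hasSum_le (fun n => ?_) h0 (h2.add h1)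
  have hpos : 0 < 4 * Real.pi ^ 2 * ((N : ℝ) + 1) ^ 2 := by positivity
  by_cases hn : n ∈ latticeBox ι N
  · rw [if_pos hn]
    exact le_add_of_nonneg_right (by positivity)
  · rw [if_neg hn, zero_add, ← div_eq_inv_mul, le_div_iff₀ hpos, mul_comm, ← Finset.sum_mul]
    refine mul_le_mul_of_nonneg_right ?_ (by positivity)
    simp only [latticeBox, Fintype.mem_piFinset, Finset.mem_Icc, not_forall] at hn
    obtain ⟨i, hi'⟩ := hn
    have h3 : ((N : ℤ) + 1) ^ 2 ≤ n i ^ 2 := by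
      refine sq_le_sq.2 ?_
      rw [abs_of_nonneg (by positivity)]
      rcases abs_cases (n i) with h | h <;> omega
    have h4 : ((N : ℝ) + 1) ^ 2 ≤ (n i : ℝ) ^ 2 := by exact_mod_cast h3
    calc 4 * Real.pi ^ 2 * ((N : ℝ) + 1) ^ 2 ≤ 4 * Real.pi ^ 2 * (n i : ℝ) ^ 2 := by gcongr
      _ = (2 * Real.pi * n i) ^ 2 := by ring
      _ ≤ _ := Finset.single_le_sum (f := fun i => (2 * Real.pi * (n i : ℝ)) ^ 2)
        (fun _ _ => sq_nonneg _) (Finset.mem_univ i)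

/-- The Poincaré inequality on the torus. -/
theorem TorusContDiff.integral_sq_le_of_integral_eq_zero {f : UnitAddTorus ι → ℝ}
    (hf : TorusContDiff 1 f) (h0 : ∫ x, f x = 0) :
    4 * Real.pi ^ 2 * ∫ x, f x ^ 2 ≤ ∑ i, ∫ x, pd i f x ^ 2 := by
  -- For $N=0$ the only low frequency is the mean, which vanishes, and the constant is sharp.
  have h := hf.integral_sq_le 0
  have hb : latticeBox ι 0 = {0} := by
    ext n; simp [latticeBox, funext_iff]
  have hc : torusCoeff (fun x => (f x : ℂ)) 0 = 0 := by
    have : ∫ x, (f x : ℂ) = 0 := by rw [integral_complex_ofReal, h0]; simp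
    simpa [torusCoeff, mFourier_zero] using this
  rw [hb, Finset.sum_singleton, hc] at h
  have hp : 0 < 4 * Real.pi ^ 2 := by positivity
  rw [← le_div_iff₀' hp, div_eq_inv_mul]
  simpa using h

/-- A form of the Nash inequality on the torus. -/
theorem TorusContDiff.integral_sq_le_nash {f : UnitAddTorus ι → ℝ} (hf : TorusContDiff 1 f)
    {R : ℝ} (hR : 1 ≤ R) :
    4 * Real.pi ^ 2 * R ^ 2 * ((∫ x, f x ^ 2) - (3 * R) ^ Fintype.card ι * (∫ x, |f x|) ^ 2) ≤
      ∑ i, ∫ x, pd i f x ^ 2 := by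
  have hN : (⌊R⌋₊ : ℝ) ≤ R := Nat.floor_le (by linarith)
  have hN' : R < ⌊R⌋₊ + 1 := Nat.lt_floor_add_one R
  set N := ⌊R⌋₊
  have h := hf.integral_sq_le N
  have hG : 0 ≤ ∑ i, ∫ x, pd i f x ^ 2 :=
    Finset.sum_nonneg fun i _ => integral_nonneg fun x => sq_nonneg _
  -- Each low-frequency coefficient is at most $\|f\|_1$, and the box has $(2N+1)^d\le(3R)^d$ points
  -- since $N\le R$ and $R\ge1$.
  have h1 : ∑ n ∈ latticeBox ι N, ‖torusCoeff (fun x => (f x : ℂ)) n‖ ^ 2 ≤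
      (3 * R) ^ Fintype.card ι * (∫ x, |f x|) ^ 2 := by
    calc _ ≤ ∑ n ∈ latticeBox ι N, (∫ x, |f x|) ^ 2 :=
          Finset.sum_le_sum fun n _ => by gcongr; exact norm_torusCoeff_le f n
      _ = (2 * N + 1 : ℝ) ^ Fintype.card ι * (∫ x, |f x|) ^ 2 := by
          rw [Finset.sum_const, card_latticeBox]; simp
      _ ≤ _ := by gcongr; linarith
  have h2 : (4 * Real.pi ^ 2 * ((N : ℝ) + 1) ^ 2)⁻¹ * ∑ i, ∫ x, pd i f x ^ 2 ≤
      (4 * Real.pi ^ 2 * R ^ 2)⁻¹ * ∑ i, ∫ x, pd i f x ^ 2 := by gcongr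
  have hp : 0 < 4 * Real.pi ^ 2 * R ^ 2 := by positivity
  rw [← le_div_iff₀' hp, div_eq_inv_mul]
  linarith

end FourierInequality

/-! ### Regularity of integrals over a compact parameter space. -/

section ParametricIntegral

open Filter Topology

/-- Local closedness makes the subtype locally compact; it covers both the closed time range
$[0,\infty)$ and the open one $(0,\infty)$. -/
theorem continuousOn_integral_of_compact {X Y E : Type*} [TopologicalSpace X]
    [FirstCountableTopology X] [LocallyCompactSpace X] [TopologicalSpace Y] [CompactSpace Y]
    [MeasurableSpace Y] [OpensMeasurableSpace Y] [NormedAddCommGroup E] [NormedSpace ℝ E]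
    [SecondCountableTopologyEither Y E] {μ : Measure Y} [IsFiniteMeasure μ]
    {s : Set X} (hs : IsLocallyClosed s) {f : X → Y → E}
    (hf : ContinuousOn (fun q : X × Y => f q.1 q.2) (s ×ˢ univ)) :
    ContinuousOn (fun x => ∫ y, f x y ∂μ) s := by
  rw [continuousOn_iff_continuous_domRestrict]
  have : LocallyCompactSpace s := hs.locallyCompactSpace
  have h := continuous_parametric_integral_of_continuous (X := s) (μ := μ) (s := univ)
    (f := fun (x : s) y => f x y) (hf.comp_continuous (f := fun q : s × Y => ((q.1 : X), q.2)) (by fun_prop) (by simp))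
    isCompact_univ
  simpa using! h

theorem contDiffOn_integral_of_compact {V Y : Type*} [NormedAddCommGroup V] [NormedSpace ℝ V]
    [FiniteDimensional ℝ V] [TopologicalSpace Y] [CompactSpace Y] [SecondCountableTopology Y]
    [MeasurableSpace Y] [OpensMeasurableSpace Y] {μ : Measure Y} [IsFiniteMeasure μ]
    {s : Set V} (hs : IsOpen s) {f : V → Y → ℝ} {f' : V → Y → V →L[ℝ] ℝ}
    (hf : ContinuousOn (fun q : V × Y => f q.1 q.2) (s ×ˢ univ))
    (hf' : ContinuousOn (fun q : V × Y => f' q.1 q.2) (s ×ˢ univ))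
    (hd : ∀ v ∈ s, ∀ y, HasFDerivAt (fun v => f v y) (f' v y) v) :
    ContDiffOn ℝ 1 (fun v => ∫ y, f v y ∂μ) s := by
  have hfy : ∀ v ∈ s, Continuous (f v) := fun v hv =>
    hf.comp_continuous (f := fun y => (v, y)) (by fun_prop) (by simp [hv])
  have hfy' : ∀ v ∈ s, Continuous (f' v) := fun v hv =>
    hf'.comp_continuous (f := fun y => (v, y)) (by fun_prop) (by simp [hv])
  have : ProperSpace V := FiniteDimensional.proper ℝ V
  have hD : ∀ v ∈ s, HasFDerivAt (fun v => ∫ y, f v y ∂μ) (∫ y, f' v y ∂μ) v := by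
    intro v hv
    obtain ⟨K, hK, hvK, hKs⟩ := exists_compact_subset hs hv
    obtain ⟨C, hC⟩ := (hK.prod (isCompact_univ (X := Y))).bddAbove_image
      ((hf'.mono (prod_mono hKs subset_rfl)).norm)
    have hKn : K ∈ 𝓝 v := mem_interior_iff_mem_nhds.1 hvK
    refine hasFDerivAt_integral_of_dominated_of_fderiv_le (s := K) (bound := fun _ => C)
      hKn ?_ ?_ ?_ ?_ (integrable_const (μ := μ) C) ?_
    · filter_upwards [hs.mem_nhds hv] with u hu
      exact (hfy u hu).aestronglyMeasurable
    · exact (hfy v hv).integrable_of_hasCompactSupport (HasCompactSupport.of_compactSpace _)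
    · exact (hfy' v hv).aestronglyMeasurable
    · exact Eventually.of_forall fun y u hu => hC ⟨(u, y), ⟨hu, mem_univ _⟩, rfl⟩
    · exact Eventually.of_forall fun y u hu => hd u (hKs hu) y
  rw [show (1 : WithTop ℕ∞) = 0 + 1 by simp, contDiffOn_succ_iff_fderiv_of_isOpen hs]
  refine ⟨fun v hv => (hD v hv).differentiableAt.differentiableWithinAt, by simp, ?_⟩
  rw [contDiffOn_zero]
  refine (continuousOn_integral_of_compact (μ := μ) hs.isLocallyClosed hf').congr fun v hv => ?_
  exact (hD v hv).fderiv

end ParametricIntegral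

/-! ### Time-dependent functions on the torus. -/

section Flow

open Filter Topology

variable {ι : Type*} [Fintype ι]

/-- A time dependent function on the torus, continuous up to time `0` and of class `C¹` for
positive times. -/
structure IsRegularFlow (w : ℝ → UnitAddTorus ι → ℝ) : Prop where
  continuousOn : ContinuousOn (fun q : ℝ × UnitAddTorus ι => w q.1 q.2) (Ici 0 ×ˢ univ)
  contDiffOn : ContDiffOn ℝ 1 (fun q : ℝ × (ι → ℝ) => w q.1 (torusMk q.2)) (Ioi 0 ×ˢ univ)

theorem isOpen_Ioi_prod_univ {X : Type*} [TopologicalSpace X] :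
    IsOpen (Ioi (0 : ℝ) ×ˢ (univ : Set X)) := isOpen_Ioi.prod isOpen_univ

namespace IsRegularFlow

variable {w : ℝ → UnitAddTorus ι → ℝ}

theorem continuous (h : IsRegularFlow w) {t : ℝ} (ht : 0 ≤ t) : Continuous (w t) :=
  h.continuousOn.comp_continuous (f := fun x => (t, x)) (by fun_prop) (by simp [ht])

theorem torusContDiff (h : IsRegularFlow w) {t : ℝ} (ht : 0 < t) : TorusContDiff 1 (w t) := by
  have := h.contDiffOn.comp (s := univ) (f := fun x : ι → ℝ => (t, x))
    (by fun_prop) (fun x _ => by simp [ht])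
  exact contDiffOn_univ.1 this

theorem hasFDerivAt (h : IsRegularFlow w) {q : ℝ × (ι → ℝ)} (hq : 0 < q.1) :
    HasFDerivAt (fun q : ℝ × (ι → ℝ) => w q.1 (torusMk q.2))
      (fderiv ℝ (fun q : ℝ × (ι → ℝ) => w q.1 (torusMk q.2)) q) q :=
  ((h.contDiffOn.differentiableOn one_ne_zero).differentiableAt
    (isOpen_Ioi_prod_univ.mem_nhds (by simp [hq]))).hasFDerivAt

theorem hasDerivAt_lift (h : IsRegularFlow w) {t : ℝ} (ht : 0 < t) (x : ι → ℝ) :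
    HasDerivAt (fun s => w s (torusMk x))
      (fderiv ℝ (fun q : ℝ × (ι → ℝ) => w q.1 (torusMk q.2)) (t, x) (1, 0)) t := by
  have h1 : HasDerivAt (fun s : ℝ => (s, x)) ((1 : ℝ), (0 : ι → ℝ)) t :=
    (hasDerivAt_id t).prodMk (hasDerivAt_const t x)
  exact (h.hasFDerivAt (q := (t, x)) ht).comp_hasDerivAt t h1

theorem hasDerivAt (h : IsRegularFlow w) {t : ℝ} (ht : 0 < t) (x : UnitAddTorus ι) :
    HasDerivAt (fun s => w s x) (deriv (fun s => w s x) t) t := by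
  obtain ⟨x, rfl⟩ := isOpenQuotientMap_torusMk.surjective x
  exact (h.hasDerivAt_lift ht x).differentiableAt.hasDerivAt

theorem continuousOn_fderiv (h : IsRegularFlow w) :
    ContinuousOn (fderiv ℝ (fun q : ℝ × (ι → ℝ) => w q.1 (torusMk q.2))) (Ioi 0 ×ˢ univ) :=
  h.contDiffOn.continuousOn_fderiv_of_isOpen isOpen_Ioi_prod_univ le_rfl

theorem continuousOn_deriv (h : IsRegularFlow w) :
    ContinuousOn (fun q : ℝ × UnitAddTorus ι => deriv (fun s => w s q.2) q.1)
      (Ioi 0 ×ˢ univ) := by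
  rintro ⟨t, x⟩ ⟨ht, -⟩
  obtain ⟨x, rfl⟩ := isOpenQuotientMap_torusMk.surjective x
  refine ContinuousAt.continuousWithinAt ?_
  have hq : IsOpenQuotientMap (Prod.map id torusMk : ℝ × (ι → ℝ) → ℝ × UnitAddTorus ι) :=
    IsOpenQuotientMap.id.prodMap isOpenQuotientMap_torusMk
  refine (hq.continuousAt_comp_iff (x := (t, x))).1 ?_
  have hn : Ioi (0 : ℝ) ×ˢ (univ : Set (ι → ℝ)) ∈ 𝓝 (t, x) :=
    isOpen_Ioi_prod_univ.mem_nhds ⟨ht, mem_univ _⟩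
  have hc := (h.continuousOn_fderiv.clm_apply
    (continuousOn_const (c := ((1 : ℝ), (0 : ι → ℝ))))).continuousAt hn
  refine hc.congr ?_
  filter_upwards [hn] with q hq
  exact (h.hasDerivAt_lift hq.1 q.2).deriv.symm

theorem comp (h : IsRegularFlow w) {g : ℝ → ℝ} (hg : ContDiff ℝ 1 g) :
    IsRegularFlow fun t x => g (w t x) :=
  ⟨hg.continuous.comp_continuousOn h.continuousOn, hg.comp_contDiffOn h.contDiffOn⟩

theorem continuousOn_integral (h : IsRegularFlow w) :
    ContinuousOn (fun t => ∫ x, w t x) (Ici 0) :=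
  continuousOn_integral_of_compact isClosed_Ici.isLocallyClosed h.continuousOn

theorem hasDerivAt_integral_mul (h : IsRegularFlow w) {φ : UnitAddTorus ι → ℝ}
    (hφ : Continuous φ) {t : ℝ} (ht : 0 < t) :
    HasDerivAt (fun s => ∫ x, φ x * w s x) (∫ x, φ x * deriv (fun s => w s x) t) t := by
  -- A compact time interval away from $0$, where the time derivative need not be bounded.
  have hK : Icc (t / 2) (t + 1) ⊆ Ioi 0 := fun s hs => lt_of_lt_of_le (by positivity) hs.1
  obtain ⟨C, hC⟩ := (isCompact_Icc.prod isCompact_univ).bddAbove_image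
    (((hφ.comp continuous_snd).continuousOn.mul
      (h.continuousOn_deriv.mono (prod_mono hK subset_rfl))).norm)
  have hdc : Continuous fun x => deriv (fun s => w s x) t :=
    h.continuousOn_deriv.comp_continuous (f := fun x => (t, x)) (by fun_prop) (by simp [ht])
  refine (hasDerivAt_integral_of_dominated_loc_of_deriv_le (s := Icc (t / 2) (t + 1))
    (bound := fun _ => C) (F := fun s x => φ x * w s x)
    (F' := fun s x => φ x * deriv (fun s => w s x) s)
    (Icc_mem_nhds (by linarith) (by linarith)) ?_
    (integrable_of_continuous (hφ.mul (h.continuous ht.le)))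
    (hφ.mul hdc).aestronglyMeasurable ?_ (integrable_const _) ?_).2
  · filter_upwards [Ioi_mem_nhds ht] with s hs
    exact (hφ.mul (h.continuous (le_of_lt hs))).aestronglyMeasurable
  · exact Eventually.of_forall fun x s hs => hC ⟨(s, x), ⟨hs, mem_univ _⟩, rfl⟩
  · exact Eventually.of_forall fun x s hs => (h.hasDerivAt (hK hs) x).const_mul _

theorem hasDerivAt_integral_comp (h : IsRegularFlow w) {g g' : ℝ → ℝ} (hg : ContDiff ℝ 1 g)
    (hg' : ∀ r, HasDerivAt g (g' r) r) {t : ℝ} (ht : 0 < t) :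
    HasDerivAt (fun s => ∫ x, g (w s x)) (∫ x, g' (w t x) * deriv (fun s => w s x) t) t := by
  have h1 := (h.comp hg).hasDerivAt_integral_mul (φ := fun _ => 1) continuous_const ht
  simp only [one_mul] at h1
  convert h1 using 1
  refine integral_congr_ae (Eventually.of_forall fun x => ?_)
  exact ((hg' _).comp t (h.hasDerivAt ht x)).deriv.symm

end IsRegularFlow

end Flow

/-! ### Regularity of the marginal density. -/

section Marginal

open Filter Topology

variable {m k : ℕ}

theorem continuous_join : Continuous fun q : UnitAddTorus (Fin m) × UnitAddTorus (Fin k) =>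
    join q.1 q.2 := by
  refine continuous_pi fun j => ?_
  rcases j with i | i
  · exact (continuous_apply i).comp continuous_fst
  · exact (continuous_apply i).comp continuous_snd

theorem join_torusMk (x : Fin m → ℝ) (y : Fin k → ℝ) :
    join (torusMk x) (torusMk y) = torusMk (Sum.elim x y) := by
  ext j; rcases j with i | i <;> rfl

theorem xi_join (x : UnitAddTorus (Fin m)) (y : UnitAddTorus (Fin k)) : xi (join x y) = x := rfl

theorem join_add_single (x : UnitAddTorus (Fin m)) (y : UnitAddTorus (Fin k)) (i : Fin m)
    (s : UnitAddCircle) : join (x + Pi.single i s) y = join x y + Pi.single (Sum.inl i) s := by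
  ext j
  rcases j with j | j
  · by_cases h : j = i
    · subst h; simp [join]
    · simp [join, h]
  · simp [join]

theorem IsRegularFlow.marginal {w : ℝ → UnitAddTorus (Fin m ⊕ Fin k) → ℝ}
    (h : IsRegularFlow w) : IsRegularFlow fun t => marginal (w t) := by
  have hf : ContinuousOn (fun q : (ℝ × UnitAddTorus (Fin m)) × UnitAddTorus (Fin k) =>
      w q.1.1 (join q.1.2 q.2)) ((Ici 0 ×ˢ univ) ×ˢ univ) :=
    h.continuousOn.comp (f := fun q : (ℝ × UnitAddTorus (Fin m)) × UnitAddTorus (Fin k) =>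
      (q.1.1, join q.1.2 q.2)) (Continuous.continuousOn (by
        refine Continuous.prodMk (by fun_prop) ?_
        exact continuous_join.comp (by fun_prop : Continuous
          fun q : (ℝ × UnitAddTorus (Fin m)) × UnitAddTorus (Fin k) => (q.1.2, q.2))))
      (fun q hq => ⟨hq.1.1, mem_univ _⟩)
  refine ⟨?_, ?_⟩
  · exact continuousOn_integral_of_compact
      (f := fun (q : ℝ × UnitAddTorus (Fin m)) y => w q.1 (join q.2 y))
      (isClosed_Ici.prod isClosed_univ).isLocallyClosed hf
  -- The linear embedding $(t,x)\mapsto(t,(x,0))$; adding $(0,(0,y))$ gives the slice at $y$, so the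
  -- slice derivatives are those of the full lift composed with $A$.
  · let A : ℝ × (Fin m → ℝ) →L[ℝ] ℝ × (Fin m ⊕ Fin k → ℝ) :=
      (ContinuousLinearMap.fst ℝ ℝ (Fin m → ℝ)).prod (ContinuousLinearMap.pi fun j =>
        Sum.elim (fun i => (ContinuousLinearMap.proj i).comp
          (ContinuousLinearMap.snd ℝ ℝ (Fin m → ℝ))) (fun _ => 0) j)
    have hA : ∀ (v : ℝ × (Fin m → ℝ)) (y : Fin k → ℝ),
        A v + (0, Sum.elim (0 : Fin m → ℝ) y) = (v.1, Sum.elim v.2 y) := by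
      intro v y
      ext j
      · simp [A]
      · rcases j with j | j <;> simp [A]
    have hlift : ∀ (v : ℝ × (Fin m → ℝ)) (y : Fin k → ℝ), 0 < v.1 →
        HasFDerivAt (fun v : ℝ × (Fin m → ℝ) => w v.1 (join (torusMk v.2) (torusMk y)))
          ((fderiv ℝ (fun q : ℝ × (Fin m ⊕ Fin k → ℝ) => w q.1 (torusMk q.2))
            (v.1, Sum.elim v.2 y)).comp A) v := by
      intro v y hv
      have h1 : HasFDerivAt (fun v => A v + (0, Sum.elim (0 : Fin m → ℝ) y)) A v :=
        A.hasFDerivAt.add_const _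
      have h2 := h.hasFDerivAt (q := A v + (0, Sum.elim (0 : Fin m → ℝ) y)) (by rw [hA]; exact hv)
      have h3 := h2.comp v h1
      simp only [hA, Function.comp_def] at h3
      simpa only [join_torusMk] using h3
    refine contDiffOn_integral_of_compact (V := ℝ × (Fin m → ℝ)) (Y := UnitAddTorus (Fin k))
      (s := Ioi 0 ×ˢ univ) isOpen_Ioi_prod_univ
      (f := fun v y => w v.1 (join (torusMk v.2) y))
      (f' := fun v y => fderiv ℝ (fun v : ℝ × (Fin m → ℝ) => w v.1 (join (torusMk v.2) y)) v)
      ?_ ?_ ?_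
    · refine hf.comp (f := fun q : (ℝ × (Fin m → ℝ)) × UnitAddTorus (Fin k) =>
        ((q.1.1, torusMk q.1.2), q.2)) (Continuous.continuousOn ?_)
        fun q hq => ⟨⟨(mem_Ioi.1 hq.1.1).le, mem_univ _⟩, mem_univ _⟩
      exact ((by fun_prop : Continuous fun q : (ℝ × (Fin m → ℝ)) × UnitAddTorus (Fin k) =>
        q.1.1).prodMk (isOpenQuotientMap_torusMk.continuous.comp (by fun_prop))).prodMk
        (by fun_prop)
    · rintro ⟨⟨t, x⟩, y⟩ ⟨⟨ht, -⟩, -⟩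
      obtain ⟨y, rfl⟩ := isOpenQuotientMap_torusMk.surjective y
      refine ContinuousAt.continuousWithinAt ?_
      have hq : IsOpenQuotientMap (Prod.map id torusMk :
          (ℝ × (Fin m → ℝ)) × (Fin k → ℝ) → (ℝ × (Fin m → ℝ)) × UnitAddTorus (Fin k)) :=
        IsOpenQuotientMap.id.prodMap isOpenQuotientMap_torusMk
      refine (hq.continuousAt_comp_iff (x := ((t, x), y))).1 ?_
      have hn : {q : (ℝ × (Fin m → ℝ)) × (Fin k → ℝ) | 0 < q.1.1} ∈ 𝓝 ((t, x), y) :=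
        (isOpen_lt continuous_const (by fun_prop)).mem_nhds ht
      have hj : Continuous fun q : (ℝ × (Fin m → ℝ)) × (Fin k → ℝ) =>
          (q.1.1, (Sum.elim q.1.2 q.2 : Fin m ⊕ Fin k → ℝ)) := by
        refine Continuous.prodMk (by fun_prop) (continuous_pi fun j => ?_)
        rcases j with j | j <;> simp only [Sum.elim_inl, Sum.elim_inr] <;> fun_prop
      have hn' : Ioi (0 : ℝ) ×ˢ univ ∈ 𝓝 (t, (Sum.elim x y : Fin m ⊕ Fin k → ℝ)) :=
        isOpen_Ioi_prod_univ.mem_nhds ⟨ht, mem_univ _⟩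
      have hc := ((h.continuousOn_fderiv.continuousAt hn').comp
        (f := fun q : (ℝ × (Fin m → ℝ)) × (Fin k → ℝ) =>
          (q.1.1, (Sum.elim q.1.2 q.2 : Fin m ⊕ Fin k → ℝ)))
        (x := ((t, x), y)) hj.continuousAt).clm_comp (continuousAt_const (y := A))
      refine hc.congr ?_
      filter_upwards [hn] with q hq
      exact (hlift q.1 q.2 hq).fderiv.symm
    · rintro ⟨t, x⟩ ⟨ht, -⟩ y
      obtain ⟨y, rfl⟩ := isOpenQuotientMap_torusMk.surjective y
      exact (hlift (t, x) y ht).differentiableAt.hasFDerivAt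

theorem pd_marginal {ρ : UnitAddTorus (Fin m ⊕ Fin k) → ℝ} (hρ : TorusContDiff 1 ρ) (i : Fin m)
    (x : UnitAddTorus (Fin m)) :
    pd i (marginal ρ) x = ∫ y : UnitAddTorus (Fin k), pd (Sum.inl i) ρ (join x y) := by
  have hpc := hρ.continuous_pd (Sum.inl i)
  obtain ⟨C, hC⟩ := isCompact_univ.bddAbove_image hpc.norm.continuousOn
  let g : ℝ → UnitAddTorus (Fin m ⊕ Fin k) := fun s => Pi.single (Sum.inl i) (s : UnitAddCircle)
  have hj : ∀ s : ℝ, Continuous fun y : UnitAddTorus (Fin k) => join x y + g s := fun s =>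
    (continuous_join.comp (Continuous.prodMk_right x)).add continuous_const
  have hj1 : ∀ s : ℝ, Continuous fun y : UnitAddTorus (Fin k) => ρ (join x y + g s) :=
    fun s => hρ.continuous.comp (hj s)
  have hj2 : Continuous fun y : UnitAddTorus (Fin k) => pd (Sum.inl i) ρ (join x y + g 0) :=
    hpc.comp (hj 0)
  have key := (hasDerivAt_integral_of_dominated_loc_of_deriv_le
    (μ := (volume : Measure (UnitAddTorus (Fin k)))) (x₀ := (0 : ℝ))
    (s := univ) (bound := fun _ => C)
    (F := fun (s : ℝ) y => ρ (join x y + g s))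
    (F' := fun (s : ℝ) y => pd (Sum.inl i) ρ (join x y + g s))
    univ_mem (Eventually.of_forall fun s => (hj1 s).aestronglyMeasurable)
    (integrable_of_continuous (hj1 0))
    hj2.aestronglyMeasurable
    (Eventually.of_forall fun x s _ => hC ⟨_, mem_univ _, rfl⟩)
    (integrable_const _)
    (Eventually.of_forall fun y s _ =>
      hasDerivAt_translate (fun x => hρ.hasDerivAt (Sum.inl i) x) (join x y) s)).2
  simp only [g] at key
  simp only [← join_add_single] at key
  have := key.deriv
  simpa [pd, AdaptiveBiasing.marginal] using this

end Marginal

/-! ### First variation of the Helmholtz projection. -/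

section Helmholtz

variable {ι : Type*} [Fintype ι] [DecidableEq ι]

theorem TorusContDiff.hasWeakGradient {g : UnitAddTorus ι → ℝ} (hg : TorusContDiff 1 g) :
    HasWeakGradient g (fun x i => pd i g x) where
  memLp := memLp_of_continuous hg.continuous 2
  grad_memLp i := memLp_of_continuous (hg.continuous_pd i) 2
  integral_eq φ hφ i :=
    TorusContDiff.integral_mul_pd (ContDiff.of_le hφ (by exact_mod_cast le_top)) hg i

theorem HasWeakGradient.add_smul {f g : UnitAddTorus ι → ℝ} {u v : UnitAddTorus ι → ι → ℝ}
    (hf : HasWeakGradient f u) (hg : HasWeakGradient g v) (c : ℝ) :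
    HasWeakGradient (fun x => f x + c * g x) (fun x i => u x i + c * v x i) where
  memLp := hf.memLp.add (hg.memLp.const_mul c)
  grad_memLp i := (hf.grad_memLp i).add ((hg.grad_memLp i).const_mul c)
  integral_eq φ hφ i := by
    have hφ1 : TorusContDiff 1 φ := ContDiff.of_le hφ (by exact_mod_cast le_top)
    have hφc : MemLp φ 2 volume := memLp_of_continuous hφ1.continuous 2
    have hφp : MemLp (pd i φ) 2 volume := memLp_of_continuous (hφ1.continuous_pd i) 2
    have h1 : Integrable (fun x => f x * pd i φ x) volume := hf.memLp.integrable_mul hφp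
    have h2 : Integrable (fun x => c * (g x * pd i φ x)) volume :=
      (hg.memLp.integrable_mul hφp).const_mul c
    have h3 : Integrable (fun x => u x i * φ x) volume := (hf.grad_memLp i).integrable_mul hφc
    have h4 : Integrable (fun x => c * (v x i * φ x)) volume :=
      ((hg.grad_memLp i).integrable_mul hφc).const_mul c
    simp only [add_mul, mul_assoc]
    rw [integral_add h1 h2, integral_add h3 h4, integral_const_mul, integral_const_mul,
      hf.integral_eq φ hφ i, hg.integral_eq φ hφ i]
    ring

theorem eq_zero_of_forall_quadratic_nonneg {A D : ℝ} (h : ∀ c : ℝ, 0 ≤ -2 * c * A + c ^ 2 * D) :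
    A = 0 := by
  -- At this $c$ the linear term is $-2A^2/(|D|+1)$ and the quadratic one at most $A^2/(|D|+1)$,
  -- whatever the value of $D$.
  have h1 := h (A / (|D| + 1))
  have hD : 0 < |D| + 1 := by positivity
  have h2 : -2 * (A / (|D| + 1)) * A + (A / (|D| + 1)) ^ 2 * D ≤ -(A ^ 2 / (|D| + 1)) := by
    have h3 : (A / (|D| + 1)) ^ 2 * D ≤ A ^ 2 / (|D| + 1) := by
      rw [div_pow, div_mul_eq_mul_div, div_le_div_iff₀ (by positivity) hD]
      have : D ≤ |D| + 1 := (le_abs_self D).trans (by linarith)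
      nlinarith [mul_nonneg (sq_nonneg A) hD.le]
    have h4 : -2 * (A / (|D| + 1)) * A = -2 * (A ^ 2 / (|D| + 1)) := by ring
    linarith
  have h5 : A ^ 2 / (|D| + 1) ≤ 0 := by linarith
  rw [div_le_iff₀ hD, zero_mul] at h5
  exact pow_eq_zero_iff two_ne_zero |>.1 (le_antisymm h5 (sq_nonneg A))

theorem IsHelmholtzProjection.memLp {f b : UnitAddTorus ι → ι → ℝ}
    (h : IsHelmholtzProjection f b) (i : ι) : MemLp (fun x => b x i) 2 volume := by
  obtain ⟨H, hH, -⟩ := h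
  exact hH.grad_memLp i

/-- The Helmholtz residual is orthogonal to gradients. -/
theorem IsHelmholtzProjection.integral_residual_mul_pd {f b : UnitAddTorus ι → ι → ℝ}
    (h : IsHelmholtzProjection f b) (hf : ∀ i, MemLp (fun x => f x i) 2 volume)
    {g : UnitAddTorus ι → ℝ} (hg : TorusContDiff 1 g) :
    ∫ x, ∑ i, (f x i - b x i) * pd i g x = 0 := by
  obtain ⟨H, hH, hH0, hmin⟩ := h
  have hg0 : TorusContDiff 1 (fun x => g x - ∫ y, g y) :=
    hg.comp_left (g := fun r => r - ∫ y, g y) (by fun_prop)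
  have hr : ∀ i, MemLp (fun x => f x i - b x i) 2 volume := fun i => (hf i).sub (hH.grad_memLp i)
  have hp : ∀ i, MemLp (pd i g) 2 volume := fun i => memLp_of_continuous (hg.continuous_pd i) 2
  have i1 : Integrable (fun x => ∑ i, (f x i - b x i) ^ 2) volume :=
    integrable_finsetSum _ fun i _ => (hr i).integrable_sq
  have i2 : Integrable (fun x => ∑ i, (f x i - b x i) * pd i g x) volume :=
    integrable_finsetSum _ fun i _ => (hr i).integrable_mul (hp i)
  have i3 : Integrable (fun x => ∑ i, pd i g x ^ 2) volume :=
    integrable_finsetSum _ fun i _ => (hp i).integrable_sq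
  refine eq_zero_of_forall_quadratic_nonneg (D := ∫ x, ∑ i, pd i g x ^ 2) fun c => ?_
  -- The competitor is $H+c\,(g-\int g)$; centring $g$ keeps it admissible and leaves its gradient
  -- unchanged.
  have hm0 : ∫ x, (H x + c * (g x - ∫ y, g y)) = 0 := by
    have j1 : Integrable H volume := hH.memLp.integrable one_le_two
    have j2 : Integrable (fun x => c * (g x - ∫ y, g y)) volume :=
      (integrable_of_continuous hg0.continuous).const_mul c
    rw [integral_add j1 j2, integral_const_mul,
      integral_sub (integrable_of_continuous hg.continuous) (integrable_const _), hH0]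
    simp
  have key := hmin _ _ (hH.add_smul hg0.hasWeakGradient c) hm0
  simp only [hg.pd_sub_const] at key
  have e : ∀ x, ∑ i, (f x i - (b x i + c * pd i g x)) ^ 2 = (∑ i, (f x i - b x i) ^ 2)
      + (-2 * c * (∑ i, (f x i - b x i) * pd i g x) + c ^ 2 * ∑ i, pd i g x ^ 2) := by
    intro x
    simp only [Finset.mul_sum, ← Finset.sum_add_distrib]
    exact Finset.sum_congr rfl fun i _ => by ring
  simp only [e] at key
  have i4 : Integrable (fun x => -2 * c * ∑ i, (f x i - b x i) * pd i g x) volume :=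
    i2.const_mul _
  have i5 : Integrable (fun x => c ^ 2 * ∑ i, pd i g x ^ 2) volume := i3.const_mul _
  have i6 : Integrable (fun x => -2 * c * (∑ i, (f x i - b x i) * pd i g x)
    + c ^ 2 * ∑ i, pd i g x ^ 2) volume := i4.add i5
  rw [integral_add i1 i6, integral_add i4 i5, integral_const_mul, integral_const_mul] at key
  linarith

end Helmholtz

/-! ### The equation of the marginal and the dissipation of its moments. -/

section MarginalEquation

open Filter Topology

variable {m k : ℕ}

theorem join_eq_sumPiEquivProdPi_symm :
    (fun q : UnitAddTorus (Fin m) × UnitAddTorus (Fin k) => join q.1 q.2) =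
      (MeasurableEquiv.sumPiEquivProdPi (fun _ : Fin m ⊕ Fin k => UnitAddCircle)).symm := by
  funext q j
  rcases j with j | j <;> rfl

theorem measurePreserving_join : MeasurePreserving
    (fun q : UnitAddTorus (Fin m) × UnitAddTorus (Fin k) => join q.1 q.2) volume volume := by
  rw [join_eq_sumPiEquivProdPi_symm]
  exact volume_measurePreserving_sumPiEquivProdPi_symm _

theorem measurableEmbedding_join : MeasurableEmbedding
    (fun q : UnitAddTorus (Fin m) × UnitAddTorus (Fin k) => join q.1 q.2) := by
  rw [join_eq_sumPiEquivProdPi_symm]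
  exact MeasurableEquiv.measurableEmbedding _

theorem integral_join {f : UnitAddTorus (Fin m ⊕ Fin k) → ℝ} (hf : Integrable f volume) :
    ∫ z, f z = ∫ x : UnitAddTorus (Fin m), ∫ y : UnitAddTorus (Fin k), f (join x y) := by
  rw [← measurePreserving_join.integral_comp measurableEmbedding_join]
  exact integral_prod _ ((measurePreserving_join.integrable_comp_emb measurableEmbedding_join).2 hf)

theorem integrable_comp_xi {f : UnitAddTorus (Fin m) → ℝ} (hf : Integrable f volume) :
    Integrable (fun z : UnitAddTorus (Fin m ⊕ Fin k) => f (xi z)) volume := by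
  rw [← measurePreserving_join.integrable_comp_emb measurableEmbedding_join]
  exact hf.comp_fst _

theorem continuous_xi : Continuous (xi : UnitAddTorus (Fin m ⊕ Fin k) → UnitAddTorus (Fin m)) :=
  continuous_pi fun i => continuous_apply (Sum.inl i)

theorem pd_comp_xi_inl (φ : UnitAddTorus (Fin m) → ℝ) (i : Fin m)
    (z : UnitAddTorus (Fin m ⊕ Fin k)) : pd (Sum.inl i) (fun z => φ (xi z)) z = pd i φ (xi z) := by
  have h : ∀ s : UnitAddCircle, xi (z + Pi.single (Sum.inl i) s) = xi z + Pi.single i s := by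
    intro s
    ext j
    by_cases h : j = i
    · subst h; simp [xi]
    · simp [xi, h]
  simp only [pd, h]

theorem pd_comp_xi_inr (φ : UnitAddTorus (Fin m) → ℝ) (i : Fin k)
    (z : UnitAddTorus (Fin m ⊕ Fin k)) : pd (Sum.inr i) (fun z => φ (xi z)) z = 0 := by
  have h : ∀ s : UnitAddCircle, xi (z + Pi.single (Sum.inr i) s) = xi z := by
    intro s; ext j; simp [xi]
  simp [pd, h]

theorem TorusContDiff.comp_xi {r : WithTop ℕ∞} {φ : UnitAddTorus (Fin m) → ℝ}
    (hφ : TorusContDiff r φ) :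
    TorusContDiff r (fun z : UnitAddTorus (Fin m ⊕ Fin k) => φ (xi z)) := by
  have h : ContDiff ℝ r (fun z : Fin m ⊕ Fin k → ℝ => fun i => z (Sum.inl i)) := by fun_prop
  have hφ' : ContDiff ℝ r fun x => φ (torusMk x) := hφ
  exact hφ'.comp h

theorem continuous_integral_join {f : UnitAddTorus (Fin m ⊕ Fin k) → ℝ} (hf : Continuous f) :
    Continuous fun x : UnitAddTorus (Fin m) => ∫ y : UnitAddTorus (Fin k), f (join x y) := by
  rw [← continuousOn_univ]
  exact continuousOn_integral_of_compact (f := fun x y => f (join x y))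
    isClosed_univ.isLocallyClosed (hf.comp continuous_join).continuousOn

section MeanForce

variable {F : UnitAddTorus (Fin m ⊕ Fin k) → Fin m ⊕ Fin k → ℝ}
  {ρ : UnitAddTorus (Fin m ⊕ Fin k) → ℝ}

theorem meanForce_eq_div (x : UnitAddTorus (Fin m)) (i : Fin m) : meanForce F ρ x i =
    -(∫ y : UnitAddTorus (Fin k), F (join x y) (Sum.inl i) * ρ (join x y)) / marginal ρ x := by
  simp only [meanForce, ← mul_div_assoc, neg_mul]
  rw [integral_div, integral_neg]

theorem continuous_join_right (x : UnitAddTorus (Fin m)) :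
    Continuous fun y : UnitAddTorus (Fin k) => join x y :=
  continuous_join.comp (Continuous.prodMk_right x)

theorem abs_integral_mul_le {f : UnitAddTorus (Fin m ⊕ Fin k) → ℝ} {C : ℝ}
    (hf : Continuous f) (hC : ∀ z, |f z| ≤ C)
    (hρ : Continuous ρ) (h0 : ∀ z, 0 ≤ ρ z) (x : UnitAddTorus (Fin m)) :
    |∫ y : UnitAddTorus (Fin k), f (join x y) * ρ (join x y)| ≤ C * marginal ρ x := by
  have hj := continuous_join_right (k := k) x
  have h1 : Continuous fun y : UnitAddTorus (Fin k) => ρ (join x y) := hρ.comp hj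
  have h2 : Continuous fun y : UnitAddTorus (Fin k) => f (join x y) := hf.comp hj
  rw [marginal, ← integral_const_mul]
  refine (abs_integral_le_integral_abs).trans (integral_mono
    (integrable_of_continuous (h2.mul h1).abs) (integrable_of_continuous (continuous_const.mul h1))
    fun y => ?_)
  simp only [abs_mul, abs_of_nonneg (h0 _)]
  exact mul_le_mul_of_nonneg_right (hC _) (h0 _)

/-- This holds even where the marginal vanishes: the integral on the right is bounded by a constant
times the marginal, so it vanishes there too. Positivity of the marginal therefore need not be
propagated in time. -/
theorem meanForce_mul_marginal (hF : Continuous F) (hρ : Continuous ρ) (h0 : ∀ z, 0 ≤ ρ z)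
    (x : UnitAddTorus (Fin m)) (i : Fin m) : meanForce F ρ x i * marginal ρ x =
    -∫ y : UnitAddTorus (Fin k), F (join x y) (Sum.inl i) * ρ (join x y) := by
  rw [meanForce_eq_div]
  by_cases h : marginal ρ x = 0
  · have hFi : Continuous fun z => F z (Sum.inl i) := (continuous_apply _).comp hF
    obtain ⟨C, hC⟩ := isCompact_univ.bddAbove_image hFi.norm.continuousOn
    have := abs_integral_mul_le hFi (fun z => hC ⟨z, mem_univ _, rfl⟩) hρ h0 x
    rw [h, mul_zero, abs_nonpos_iff] at this
    rw [this, h]; simp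
  · exact div_mul_cancel₀ _ h

theorem memLp_meanForce (hF : Continuous F) (hρ : Continuous ρ) (h0 : ∀ z, 0 ≤ ρ z) (i : Fin m) :
    MemLp (fun x => meanForce F ρ x i) 2 volume := by
  have hFi : Continuous fun z => F z (Sum.inl i) := (continuous_apply _).comp hF
  obtain ⟨C, hC⟩ := isCompact_univ.bddAbove_image hFi.norm.continuousOn
  have hC' : ∀ z, |F z (Sum.inl i)| ≤ C := fun z => hC ⟨z, mem_univ _, rfl⟩
  have hC0 : 0 ≤ C := (abs_nonneg _).trans (hC' 0)
  simp only [meanForce_eq_div]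
  refine MemLp.of_bound ?_ C (Eventually.of_forall fun x => ?_)
  · have h1 : Continuous fun x : UnitAddTorus (Fin m) =>
        -∫ y : UnitAddTorus (Fin k), F (join x y) (Sum.inl i) * ρ (join x y) :=
      (continuous_integral_join (hFi.mul hρ)).neg
    have h2 : Continuous fun x : UnitAddTorus (Fin m) => marginal ρ x :=
      continuous_integral_join hρ
    exact (h1.measurable.div h2.measurable).aestronglyMeasurable
  · have hm : 0 ≤ marginal ρ x := integral_nonneg fun y => h0 _
    rw [Real.norm_eq_abs, abs_div, abs_neg, abs_of_nonneg hm]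
    -- Where the marginal is zero the quotient is $0$ by convention, so the bound $C$ persists.
    exact div_le_of_le_mul₀ hm hC0 (abs_integral_mul_le hFi hC' hρ h0 x)

variable {a : Algorithm} {b : UnitAddTorus (Fin m) → Fin m → ℝ}

theorem Algorithm.IsBias.memLp (h : a.IsBias (meanForce F ρ) b) (hF : Continuous F)
    (hρ : Continuous ρ) (h0 : ∀ z, 0 ≤ ρ z) (i : Fin m) : MemLp (fun x => b x i) 2 volume := by
  cases a with
  | ABF => rw [show b = meanForce F ρ from h]; exact memLp_meanForce hF hρ h0 i
  | PABF => exact IsHelmholtzProjection.memLp h i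

/-- For both algorithms the bias differs from the mean force by a divergence free field. -/
theorem Algorithm.IsBias.integral_residual_mul_pd (h : a.IsBias (meanForce F ρ) b)
    (hF : Continuous F) (hρ : Continuous ρ) (h0 : ∀ z, 0 ≤ ρ z)
    {g : UnitAddTorus (Fin m) → ℝ} (hg : TorusContDiff 1 g) :
    ∫ x, ∑ i, (b x i - meanForce F ρ x i) * pd i g x = 0 := by
  cases a with
  | ABF => rw [show b = meanForce F ρ from h]; simp
  | PABF =>
    have := IsHelmholtzProjection.integral_residual_mul_pd h (memLp_meanForce hF hρ h0) hg
    rw [← neg_eq_zero, ← integral_neg]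
    simpa only [← Finset.sum_neg_distrib, ← neg_mul, neg_sub] using this

end MeanForce

namespace IsSolution

variable {a : Algorithm} {β : ℝ} {F : UnitAddTorus (Fin m ⊕ Fin k) → Fin m ⊕ Fin k → ℝ}
  {π : ℝ → UnitAddTorus (Fin m ⊕ Fin k) → ℝ} {B : ℝ → UnitAddTorus (Fin m) → Fin m → ℝ}

theorem isRegularFlow (h : IsSolution a β F π B) : IsRegularFlow π :=
  ⟨h.continuousOn, h.contDiffOn⟩

/-- The weak equation satisfied by the marginal density. -/
theorem integral_mul_deriv_marginal (h : IsSolution a β F π B) (hF : Continuous F)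
    {φ : UnitAddTorus (Fin m) → ℝ} (hφ : TorusContDiff 1 φ) {t : ℝ} (ht : 0 < t) :
    ∫ x, φ x * deriv (fun s => marginal (π s) x) t =
      ∫ x, ∑ i, (-(β⁻¹ * pd i (marginal (π t)) x)
        + (B t x i - meanForce F (π t) x i) * marginal (π t) x) * pd i φ x := by
  have hr := h.isRegularFlow
  have hπc := hr.continuous ht.le
  have hπ1 := hr.torusContDiff ht
  have h0 := h.nonneg t ht.le
  have d1 := hr.marginal.hasDerivAt_integral_mul hφ.continuous ht
  have d2 := h.hasDerivAt _ (hφ.comp_xi (k := k)) t ht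
  have e1 : (fun s => ∫ x, φ x * AdaptiveBiasing.marginal (π s) x) =ᶠ[𝓝 t]
      fun s => ∫ z, φ (xi z) * π s z := by
    filter_upwards [Ioi_mem_nhds ht] with s hs
    have hi : Integrable (fun z => φ (xi z) * π s z) volume := integrable_of_continuous
      ((hφ.continuous.comp continuous_xi).mul (hr.continuous (mem_Ioi.1 hs).le))
    rw [integral_join hi]
    simp only [xi_join, integral_const_mul]
    rfl
  rw [d1.unique (d2.congr_of_eventuallyEq e1)]
  have hBL : ∀ i, MemLp (fun x => B t x i) 2 volume :=
    (h.isBias t ht.le).memLp hF hπc h0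
  have hFc : ∀ j, Continuous fun z => F z j := fun j => (continuous_apply j).comp hF
  simp only [Fintype.sum_sum_type, pd_comp_xi_inl, pd_comp_xi_inr, mul_zero,
    Finset.sum_const_zero, add_zero, drift, Sum.elim_inl]
  have hI : Integrable (fun z : UnitAddTorus (Fin m ⊕ Fin k) => ∑ i : Fin m,
      (-(β⁻¹ * pd (Sum.inl i) (π t) z) + (F z (Sum.inl i) + B t (xi z) i) * π t z)
        * pd i φ (xi z)) volume := by
    refine integrable_finsetSum _ fun i _ => ?_
    have hpφ : Continuous fun z : UnitAddTorus (Fin m ⊕ Fin k) => pd i φ (xi z) :=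
      (hφ.continuous_pd i).comp continuous_xi
    have c1 : Continuous fun z : UnitAddTorus (Fin m ⊕ Fin k) =>
        (-(β⁻¹ * pd (Sum.inl i) (π t) z) + F z (Sum.inl i) * π t z) * pd i φ (xi z) :=
      ((continuous_const.mul (hπ1.continuous_pd _)).neg.add ((hFc _).mul hπc)).mul hpφ
    have c2 : Continuous fun z : UnitAddTorus (Fin m ⊕ Fin k) => π t z * pd i φ (xi z) :=
      hπc.mul hpφ
    obtain ⟨C, hC⟩ := isCompact_univ.bddAbove_image c2.norm.continuousOn
    -- The bias is only known to be in $L^2$, so its term is treated as integrable times bounded.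
    have i2 := (integrable_comp_xi (k := k) ((hBL i).integrable one_le_two)).mul_bdd
      c2.aestronglyMeasurable (Eventually.of_forall fun z => hC ⟨z, mem_univ _, rfl⟩)
    refine ((integrable_of_continuous c1).add i2).congr (Eventually.of_forall fun z => ?_)
    simp only [Pi.add_apply]
    ring
  rw [integral_join hI]
  refine integral_congr_ae (Eventually.of_forall fun x => ?_)
  simp only [xi_join]
  have hj := continuous_join_right (k := k) x
  have k1 : ∀ i, Continuous fun y : UnitAddTorus (Fin k) => pd (Sum.inl i) (π t) (join x y) :=
    fun i => (hπ1.continuous_pd _).comp hj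
  have k2 : Continuous fun y : UnitAddTorus (Fin k) => π t (join x y) := hπc.comp hj
  have k3 : ∀ i, Continuous fun y : UnitAddTorus (Fin k) => F (join x y) (Sum.inl i) :=
    fun i => (hFc _).comp hj
  have j0 : ∀ i, Integrable (fun y : UnitAddTorus (Fin k) =>
      (-(β⁻¹ * pd (Sum.inl i) (π t) (join x y)) + (F (join x y) (Sum.inl i) + B t x i)
        * π t (join x y)) * pd i φ x) volume := fun i => integrable_of_continuous
    (((continuous_const.mul (k1 i)).neg.add (((k3 i).add continuous_const).mul k2)).mul
      continuous_const)
  rw [integral_finsetSum _ fun i _ => j0 i]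
  refine Finset.sum_congr rfl fun i _ => ?_
  rw [integral_mul_const, sub_mul, meanForce_mul_marginal hF hπc h0, pd_marginal hπ1]
  congr 1
  simp only [add_mul]
  have j1 : Integrable (fun y : UnitAddTorus (Fin k) =>
      -(β⁻¹ * pd (Sum.inl i) (π t) (join x y))) volume :=
    integrable_of_continuous (continuous_const.mul (k1 i)).neg
  have j2 : Integrable (fun y : UnitAddTorus (Fin k) =>
      F (join x y) (Sum.inl i) * π t (join x y)) volume :=
    integrable_of_continuous ((k3 i).mul k2)
  have j3 : Integrable (fun y : UnitAddTorus (Fin k) => B t x i * π t (join x y)) volume :=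
    integrable_of_continuous (continuous_const.mul k2)
  have j4 : Integrable (fun y : UnitAddTorus (Fin k) =>
      F (join x y) (Sum.inl i) * π t (join x y) + B t x i * π t (join x y)) volume := j2.add j3
  rw [integral_add j1 j4, integral_add j2 j3, integral_neg, integral_const_mul,
    integral_const_mul, AdaptiveBiasing.marginal]
  ring

theorem integral_marginal (h : IsSolution a β F π B) {t : ℝ} (ht : 0 ≤ t) :
    ∫ x, marginal (π t) x = 1 := by
  have h1 := h.integral_eq_one t ht
  rwa [integral_join (integrable_of_continuous (h.isRegularFlow.continuous ht))] at h1

/-- The dissipation of the even moments of the centred marginal density. -/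
theorem hasDerivAt_integral_pow (h : IsSolution a β F π B) (hβ : 0 < β) (hF : Continuous F)
    (p : ℕ) {t : ℝ} (ht : 0 < t) :
    ∃ D : ℝ, HasDerivAt (fun s => ∫ x, (marginal (π s) x - 1) ^ (2 * p + 2)) D t ∧
      D ≤ -(2 * β⁻¹ * ∑ i, ∫ x, pd i (fun x => (marginal (π t) x - 1) ^ (p + 1)) x ^ 2) := by
  have hr := h.isRegularFlow
  have hπc := hr.continuous ht.le
  have hu := hr.marginal.torusContDiff ht
  have h0 := h.nonneg t ht.le
  set u := AdaptiveBiasing.marginal (π t) with hu'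
  have hpow : ∀ n : ℕ, ∀ r : ℝ, HasDerivAt (fun r : ℝ => (r - 1) ^ (n + 1))
      ((n + 1) * (r - 1) ^ n) r := by
    intro n r
    have := ((hasDerivAt_id r).sub_const 1).pow (n + 1)
    simpa using! this
  have d1 := hr.marginal.hasDerivAt_integral_comp (g := fun r => (r - 1) ^ (2 * p + 2))
    (by fun_prop) (hpow (2 * p + 1)) ht
  refine ⟨_, d1, ?_⟩
  have hφ : TorusContDiff 1 (fun x => ((2 * p + 1 : ℕ) + 1 : ℝ) * (u x - 1) ^ (2 * p + 1)) :=
    hu.comp_left (g := fun r => ((2 * p + 1 : ℕ) + 1 : ℝ) * (r - 1) ^ (2 * p + 1)) (by fun_prop)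
  rw [h.integral_mul_deriv_marginal hF hφ ht]
  -- As a polynomial in $u$, this is a primitive of $(2p+2)(2p+1)(u-1)^{2p}u$: it turns the drift
  -- term $u\,(B-G)\cdot\nabla\varphi$ into $(B-G)\cdot\nabla g$, whose integral vanishes.
  have hg : TorusContDiff 1 (fun x => (2 * p + 1 : ℝ) * (u x - 1) ^ (2 * p + 2)
      + (2 * p + 2 : ℝ) * (u x - 1) ^ (2 * p + 1)) :=
    hu.comp_left (g := fun r => (2 * p + 1 : ℝ) * (r - 1) ^ (2 * p + 2)
      + (2 * p + 2 : ℝ) * (r - 1) ^ (2 * p + 1)) (by fun_prop)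
  have hdiv := (h.isBias t ht.le).integral_residual_mul_pd hF hπc h0 hg
  have p1 : ∀ i x, pd i (fun x => ((2 * p + 1 : ℕ) + 1 : ℝ) * (u x - 1) ^ (2 * p + 1)) x =
      (2 * p + 2) * (2 * p + 1) * (u x - 1) ^ (2 * p) * pd i u x := by
    intro i x
    rw [hu.pd_comp ((hpow (2 * p) (u x)).const_mul ((2 * p + 1 : ℕ) + 1 : ℝ))]
    push_cast; ring
  have p2 : ∀ i x, pd i (fun x => (2 * p + 1 : ℝ) * (u x - 1) ^ (2 * p + 2)
      + (2 * p + 2 : ℝ) * (u x - 1) ^ (2 * p + 1)) x =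
      (2 * p + 2) * (2 * p + 1) * (u x - 1) ^ (2 * p) * u x * pd i u x := by
    intro i x
    have hd := ((hpow (2 * p + 1) (u x)).const_mul (2 * p + 1 : ℝ)).add
      ((hpow (2 * p) (u x)).const_mul (2 * p + 2 : ℝ))
    refine (hu.pd_comp hd i).trans ?_
    push_cast; ring
  have p3 : ∀ i x, pd i (fun x => (u x - 1) ^ (p + 1)) x =
      (p + 1) * (u x - 1) ^ p * pd i u x := by
    intro i x
    rw [hu.pd_comp (hpow p (u x))]
  simp only [p1, p2, p3] at hdiv ⊢
  have hrL : ∀ i, MemLp (fun x => B t x i - meanForce F (π t) x i) 2 volume := fun i =>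
    ((h.isBias t ht.le).memLp hF hπc h0 i).sub (memLp_meanForce hF hπc h0 i)
  have huc := hu.continuous
  have hpc := fun i => hu.continuous_pd i
  have i1 : Integrable (fun x => ∑ i, (B t x i - meanForce F (π t) x i) *
      ((2 * p + 2) * (2 * p + 1) * (u x - 1) ^ (2 * p) * u x * pd i u x)) volume := by
    refine integrable_finsetSum _ fun i _ => (hrL i).integrable_mul (q := 2)
      (memLp_of_continuous ?_ 2)
    have := hpc i
    fun_prop
  have i2 : ∀ i, Integrable (fun x => (u x - 1) ^ (2 * p) * pd i u x ^ 2) volume := by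
    intro i
    have := hpc i
    exact integrable_of_continuous (by fun_prop)
  have i3 : Integrable (fun x => -(β⁻¹ * ((2 * p + 2) * (2 * p + 1))) *
      ∑ i, (u x - 1) ^ (2 * p) * pd i u x ^ 2) volume :=
    (integrable_finsetSum _ fun i _ => i2 i).const_mul _
  have e1 : ∀ x, ∑ i, (-(β⁻¹ * pd i u x) + (B t x i - meanForce F (π t) x i) * u x) *
      ((2 * p + 2) * (2 * p + 1) * (u x - 1) ^ (2 * p) * pd i u x) =
      -(β⁻¹ * ((2 * p + 2) * (2 * p + 1))) * (∑ i, (u x - 1) ^ (2 * p) * pd i u x ^ 2)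
      + ∑ i, (B t x i - meanForce F (π t) x i) *
      ((2 * p + 2) * (2 * p + 1) * (u x - 1) ^ (2 * p) * u x * pd i u x) := by
    intro x
    rw [Finset.mul_sum, ← Finset.sum_add_distrib]
    exact Finset.sum_congr rfl fun i _ => by ring
  have e2 : ∀ i, ∫ x, (((p : ℝ) + 1) * (u x - 1) ^ p * pd i u x) ^ 2 =
      ((p : ℝ) + 1) ^ 2 * ∫ x, (u x - 1) ^ (2 * p) * pd i u x ^ 2 := by
    intro i
    rw [← integral_const_mul]
    refine integral_congr_ae (Eventually.of_forall fun x => ?_)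
    simp only [mul_pow, ← pow_mul]
    rw [mul_comm p 2]; ring
  simp only [← hu', e1]
  rw [integral_add i3 i1, hdiv, add_zero, integral_const_mul,
    integral_finsetSum _ fun i _ => i2 i]
  simp only [e2]
  rw [← Finset.mul_sum]
  have hS : 0 ≤ ∑ i, ∫ x, (u x - 1) ^ (2 * p) * pd i u x ^ 2 :=
    Finset.sum_nonneg fun i _ => integral_nonneg fun x =>
      mul_nonneg (by rw [pow_mul]; positivity) (sq_nonneg _)
  have hb : 0 < β⁻¹ := inv_pos.2 hβ
  have hp0 : (0 : ℝ) ≤ p := Nat.cast_nonneg p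
  -- Equality at $p=0$: the dissipation constant is uniform in $p$ and loses nothing in the $L^2$
  -- rate.
  have : 2 * ((p : ℝ) + 1) ^ 2 ≤ (2 * p + 2) * (2 * p + 1) := by nlinarith
  have := mul_le_mul_of_nonneg_right this (mul_nonneg hb.le hS)
  nlinarith

end IsSolution

end MarginalEquation

/-! ### Exponential decay and Nash–Moser smoothing. -/

section Smoothing

open Filter Topology

theorem antitoneOn_of_hasDerivAt_nonpos {y : ℝ → ℝ} {s : Set ℝ} (hs : Convex ℝ s)
    (hc : ContinuousOn y s) (hd : ∀ t ∈ interior s, ∃ D, HasDerivAt y D t ∧ D ≤ 0) :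
    AntitoneOn y s := by
  refine antitoneOn_of_deriv_nonpos hs hc (fun t ht => ?_) fun t ht => ?_
  · obtain ⟨D, h, -⟩ := hd t ht
    exact h.differentiableAt.differentiableWithinAt
  · obtain ⟨D, h, hD⟩ := hd t ht
    rwa [h.deriv]

theorem le_exp_mul_of_hasDerivAt_le {y : ℝ → ℝ} {c : ℝ} (hc : ContinuousOn y (Ici 0))
    (hd : ∀ t, 0 < t → ∃ D, HasDerivAt y D t ∧ D ≤ -(c * y t)) {t : ℝ} (ht : 0 ≤ t) :
    y t ≤ Real.exp (-(c * t)) * y 0 := by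
  have h : AntitoneOn (fun t => Real.exp (c * t) * y t) (Ici 0) := by
    refine antitoneOn_of_hasDerivAt_nonpos (convex_Ici 0)
      ((by fun_prop : Continuous fun t : ℝ => Real.exp (c * t)).continuousOn.mul hc)
      fun t ht => ?_
    rw [interior_Ici] at ht
    obtain ⟨D, h, hD⟩ := hd t ht
    have h1 : HasDerivAt (fun t : ℝ => Real.exp (c * t)) (Real.exp (c * t) * (c * 1)) t :=
      ((hasDerivAt_id t).const_mul c).exp
    refine ⟨_, h1.mul h, ?_⟩
    have := Real.exp_pos (c * t)
    nlinarith
  have h1 := h (mem_Ici.2 le_rfl) (mem_Ici.2 ht) ht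
  simp only [mul_zero, Real.exp_zero, one_mul] at h1
  rw [Real.exp_neg, ← div_eq_inv_mul, le_div_iff₀' (Real.exp_pos _)]
  exact h1

/-- With $s=t-t_0$, letting the cutoff $R$ grow like $s^{-1/2}$ turns the differential inequality
into a bound by $s^{-d}M^2$, independent of the initial value $y(t_0)$. The weight $s^{d+e+1}$ kills
that value. -/
theorem pow_mul_le_of_nash {y : ℝ → ℝ} {K M t₀ τ : ℝ} {d e : ℕ} (hK : 0 < K)
    (he : K ≤ e) (hτ : 0 < τ) (hτ1 : τ ≤ 1) (hc : ContinuousOn y (Icc t₀ (t₀ + τ)))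
    (hd : ∀ t, t₀ < t → t < t₀ + τ → ∃ D, HasDerivAt y D t ∧
      ∀ R : ℝ, 1 ≤ R → D ≤ -(K * R ^ 2 * (y t - (3 * R) ^ d * M ^ 2))) :
    τ ^ d * y (t₀ + τ) ≤ (d + 1 + e) * (9 * ((d + 1 + e) / K)) ^ d * M ^ 2 := by
  set L : ℝ := d + 1 + e with hL
  set A : ℝ := L / K with hA
  have hL1 : 1 ≤ L := by
    have : (0 : ℝ) ≤ d := Nat.cast_nonneg d
    have : (0 : ℝ) ≤ e := Nat.cast_nonneg e
    linarith
  -- The integer $e\ge K$ serves to make $A\ge1$, hence $R=\sqrt{A/s}\ge1$ for $s\le1$.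
  have hA1 : 1 ≤ A := by
    rw [hA, le_div_iff₀ hK]
    have : (0 : ℝ) ≤ d := Nat.cast_nonneg d
    linarith
  have hKA : K * A = L := by rw [hA]; field_simp
  set c : ℝ := L * (9 * A) ^ d * M ^ 2 with hcdef
  have hc0 : 0 ≤ c := by positivity
  have h : AntitoneOn (fun t => (t - t₀) ^ (d + e + 1) * y t - c * (t - t₀) ^ (e + 1))
      (Icc t₀ (t₀ + τ)) := by
    refine antitoneOn_of_hasDerivAt_nonpos (convex_Icc _ _)
      (((by fun_prop : Continuous fun t : ℝ => (t - t₀) ^ (d + e + 1)).continuousOn.mul hc).sub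
        (by fun_prop)) fun t ht => ?_
    rw [interior_Icc] at ht
    obtain ⟨D, h, hD⟩ := hd t ht.1 ht.2
    have hs : 0 < t - t₀ := sub_pos.2 ht.1
    have hs1 : t - t₀ ≤ 1 := by linarith [ht.2]
    have hpow : ∀ n : ℕ, HasDerivAt (fun t : ℝ => (t - t₀) ^ (n + 1))
        ((n + 1) * (t - t₀) ^ n) t := by
      intro n
      have := ((hasDerivAt_id t).sub_const t₀).pow (n + 1)
      simpa using! this
    refine ⟨_, ((hpow (d + e)).mul h).sub ((hpow e).const_mul c), ?_⟩
    set s := t - t₀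
    have hAs : 1 ≤ A / s := by rw [le_div_iff₀ hs]; linarith
    have hR : 1 ≤ √(A / s) := Real.one_le_sqrt.2 hAs
    have hR2 : √(A / s) ^ 2 = A / s := Real.sq_sqrt (by positivity)
    have h3 : (3 * √(A / s)) ^ d ≤ (9 * (A / s)) ^ d := by
      refine pow_le_pow_left₀ (by positivity) ?_ d
      nlinarith
    have h4 := hD _ hR
    rw [hR2] at h4
    have h5 : D ≤ -(K * (A / s) * (y t - (9 * (A / s)) ^ d * M ^ 2)) := by
      refine h4.trans (neg_le_neg ?_)
      gcongr
    -- Since $KA=L=d+e+1$, the first term exactly cancels the derivative of the weight.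
    have h6 : s ^ (d + e + 1) * D ≤ -(L * s ^ (d + e) * y t) + c * s ^ e := by
      refine (mul_le_mul_of_nonneg_left h5 (by positivity)).trans (le_of_eq ?_)
      have h9 : (9 * (A / s)) ^ d = (9 * A) ^ d / s ^ d := by rw [← mul_div_assoc, div_pow]
      rw [hcdef, ← hKA, h9]
      field_simp
      ring
    have h7 : 0 ≤ c * s ^ e * e := by positivity
    have h8 : ((d + e : ℕ) : ℝ) + 1 = L := by rw [hL]; push_cast; ring
    rw [h8]
    linarith
  have h1 := h (left_mem_Icc.2 (by linarith)) (right_mem_Icc.2 (by linarith)) (by linarith)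
  simp only [sub_self, add_sub_cancel_left] at h1
  rw [zero_pow (by omega), zero_pow (by omega)] at h1
  have h2 : τ ^ (e + 1) * (τ ^ d * y (t₀ + τ)) ≤ τ ^ (e + 1) * c := by
    have : τ ^ (d + e + 1) = τ ^ (e + 1) * τ ^ d := by ring
    rw [this] at h1
    linarith
  exact le_of_mul_le_mul_left h2 (by positivity)

/-- The rescaled sequence $z_j=ab^{j+1}y_j$ satisfies $z_{j+1}\le z_j^2$. -/
theorem le_pow_of_le_mul_sq {y : ℕ → ℝ} {a b : ℝ} (ha : 1 ≤ a) (hb : 1 ≤ b) (h0 : ∀ j, 0 ≤ y j)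
    (h : ∀ j, y (j + 1) ≤ a * b ^ j * y j ^ 2) (j : ℕ) : y j ≤ (a * b * y 0) ^ 2 ^ j := by
  have key : a * b ^ (j + 1) * y j ≤ (a * b * y 0) ^ 2 ^ j := by
    induction j with
    | zero => simp
    | succ j ih =>
      calc a * b ^ (j + 1 + 1) * y (j + 1) ≤ a * b ^ (j + 1 + 1) * (a * b ^ j * y j ^ 2) := by
            gcongr; exact h j
        _ = (a * b ^ (j + 1) * y j) ^ 2 := by ring
        _ ≤ ((a * b * y 0) ^ 2 ^ j) ^ 2 := by
            have := h0 j
            gcongr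
        _ = _ := by rw [← pow_mul, ← pow_succ]
  have h1 : 1 ≤ a * b ^ (j + 1) := one_le_mul_of_one_le_of_one_le ha (one_le_pow₀ hb)
  exact (le_mul_of_one_le_left (h0 j) h1).trans key

variable {ι : Type*} [Fintype ι]

/-- If $f^2>c>Q$ somewhere, then $\{f^2>c\}$ is open and nonempty, so of positive measure; Markov's
inequality bounds that measure by $(Q/c)^{2^j}\to0$. -/
theorem sq_le_of_integral_pow_le {f : UnitAddTorus ι → ℝ} (hf : Continuous f) {Q : ℝ}
    (h : ∀ j : ℕ, ∫ x, f x ^ 2 ^ (j + 1) ≤ Q ^ 2 ^ j) (x : UnitAddTorus ι) : f x ^ 2 ≤ Q := by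
  have hQ : 0 ≤ Q := by
    have := h 0
    simp only [zero_add, pow_one, pow_zero] at this
    exact (integral_nonneg fun x => sq_nonneg _).trans this
  by_contra hx
  push Not at hx
  obtain ⟨c, hc, hcx⟩ := exists_between hx
  have hc0 : 0 < c := hQ.trans_lt hc
  have hopen : IsOpen {x | c < f x ^ 2} := isOpen_lt continuous_const (hf.pow 2)
  have hpos : 0 < (volume : Measure (UnitAddTorus ι)).real {x | c < f x ^ 2} :=
    ENNReal.toReal_pos (hopen.measure_pos volume ⟨x, hcx⟩).ne' (measure_ne_top _ _)
  have hle : ∀ j : ℕ, (volume : Measure (UnitAddTorus ι)).real {x | c < f x ^ 2} ≤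
      (Q / c) ^ 2 ^ j := by
    intro j
    rw [div_pow, le_div_iff₀ (by positivity), mul_comm]
    have hi : Integrable (fun x => f x ^ 2 ^ (j + 1)) volume := integrable_of_continuous (hf.pow _)
    have hn : ∀ x, 0 ≤ f x ^ 2 ^ (j + 1) := fun x => by
      rw [pow_succ', pow_mul]; positivity
    refine le_trans ?_ ((mul_meas_ge_le_integral_of_nonneg (Eventually.of_forall hn) hi
      (c ^ 2 ^ j)).trans (h j))
    refine mul_le_mul_of_nonneg_left (measureReal_mono fun x hx => ?_) (by positivity)
    change c ^ 2 ^ j ≤ f x ^ 2 ^ (j + 1)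
    rw [pow_succ', pow_mul]
    exact pow_le_pow_left₀ hc0.le (le_of_lt hx) _
  have ht : Tendsto (fun j : ℕ => (Q / c) ^ 2 ^ j) atTop (𝓝 0) :=
    (tendsto_pow_atTop_nhds_zero_of_lt_one (by positivity) ((div_lt_one hc0).2 hc)).comp
      (tendsto_pow_atTop_atTop_of_one_lt one_lt_two)
  exact absurd (ge_of_tendsto' ht hle) (not_le.2 hpos)

variable [DecidableEq ι]

/-- A flow of mean zero functions on the torus all of whose even moments are dissipated at least
as fast as by `∂_t w = (κ / 2) Δ w`. -/
structure IsDissipative (κ : ℝ) (w : ℝ → UnitAddTorus ι → ℝ) : Prop where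
  isRegularFlow : IsRegularFlow w
  integral_eq_zero : ∀ t, 0 ≤ t → ∫ x, w t x = 0
  hasDerivAt : ∀ (p : ℕ) (t : ℝ), 0 < t → ∃ D : ℝ,
    HasDerivAt (fun s => ∫ x, w s x ^ (2 * p + 2)) D t ∧
      D ≤ -(κ * ∑ i, ∫ x, pd i (fun x => w t x ^ (p + 1)) x ^ 2)

namespace IsDissipative

variable {κ : ℝ} {w : ℝ → UnitAddTorus ι → ℝ}

theorem continuousOn_moment (h : IsDissipative κ w) (n : ℕ) :
    ContinuousOn (fun t => ∫ x, w t x ^ n) (Ici 0) :=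
  (h.isRegularFlow.comp (g := fun r => r ^ n) (by fun_prop)).continuousOn_integral

theorem antitoneOn_moment (h : IsDissipative κ w) (hκ : 0 < κ) (p : ℕ) :
    AntitoneOn (fun t => ∫ x, w t x ^ (2 * p + 2)) (Ici 0) := by
  refine antitoneOn_of_hasDerivAt_nonpos (convex_Ici 0) (h.continuousOn_moment _) fun t ht => ?_
  rw [interior_Ici] at ht
  obtain ⟨D, h1, h2⟩ := h.hasDerivAt p t ht
  refine ⟨D, h1, h2.trans (neg_nonpos.2 (mul_nonneg hκ.le ?_))⟩
  exact Finset.sum_nonneg fun i _ => integral_nonneg fun x => sq_nonneg _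

theorem integral_sq_le_exp (h : IsDissipative κ w) (hκ : 0 < κ) {t : ℝ} (ht : 0 ≤ t) :
    ∫ x, w t x ^ 2 ≤ Real.exp (-(4 * Real.pi ^ 2 * κ * t)) * ∫ x, w 0 x ^ 2 := by
  refine le_exp_mul_of_hasDerivAt_le (h.continuousOn_moment 2) (fun t ht => ?_) ht
  obtain ⟨D, h1, h2⟩ := h.hasDerivAt 0 t ht
  refine ⟨D, h1, h2.trans (neg_le_neg ?_)⟩
  have := (h.isRegularFlow.torusContDiff ht).integral_sq_le_of_integral_eq_zero
    (h.integral_eq_zero t ht.le)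
  simp only [zero_add, pow_one]
  nlinarith

/-- The one step of the Moser iteration. -/
theorem moment_le_mul_sq (h : IsDissipative κ w) (hκ : 0 < κ) {e : ℕ}
    (he : 4 * Real.pi ^ 2 * κ ≤ e) (j : ℕ) {t₀ τ : ℝ} (ht₀ : 0 ≤ t₀) (hτ : 0 < τ) (hτ1 : τ ≤ 1) :
    τ ^ Fintype.card ι * ∫ x, w (t₀ + τ) x ^ 2 ^ (j + 2) ≤
      (Fintype.card ι + 1 + e) *
        (9 * ((Fintype.card ι + 1 + e) / (4 * Real.pi ^ 2 * κ))) ^ Fintype.card ι *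
        (∫ x, w t₀ x ^ 2 ^ (j + 1)) ^ 2 := by
  have hp : 2 ^ (j + 1) = (2 ^ (j + 1) - 1) + 1 := (Nat.sub_add_cancel Nat.one_le_two_pow).symm
  have hp2 : 2 ^ (j + 2) = 2 * (2 ^ (j + 1) - 1) + 2 := by
    have : 2 ^ (j + 2) = 2 * 2 ^ (j + 1) := by ring
    omega
  have hp3 : 2 ^ (j + 1) = 2 * (2 ^ j - 1) + 2 := by
    have : 2 ^ (j + 1) = 2 * 2 ^ j := by ring
    have := Nat.one_le_two_pow (n := j)
    omega
  have hn : ∀ r : ℝ, 0 ≤ r ^ 2 ^ (j + 1) := fun r => by rw [pow_succ', pow_mul]; positivity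
  refine pow_mul_le_of_nash (K := 4 * Real.pi ^ 2 * κ) (by positivity) he hτ hτ1
    (y := fun t => ∫ x, w t x ^ 2 ^ (j + 2))
    ((h.continuousOn_moment _).mono fun t ht => ht₀.trans ht.1) fun t h1 h2 => ?_
  have ht : 0 < t := ht₀.trans_lt h1
  obtain ⟨D, hD, hDle⟩ := h.hasDerivAt (2 ^ (j + 1) - 1) t ht
  rw [← hp2] at hD
  rw [← hp] at hDle
  refine ⟨D, hD, fun R hR => hDle.trans (neg_le_neg ?_)⟩
  have hf : TorusContDiff 1 (fun x => w t x ^ 2 ^ (j + 1)) :=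
    (h.isRegularFlow.torusContDiff ht).comp_left (g := fun r => r ^ 2 ^ (j + 1)) (by fun_prop)
  have hN := hf.integral_sq_le_nash hR
  simp only [abs_of_nonneg (hn _), ← pow_mul, ← pow_succ] at hN
  -- The $L^1$ norm of $w^{2^{j+1}}$ is the preceding moment; being nonincreasing, it can be frozen
  -- at $t_0$.
  have hanti := h.antitoneOn_moment hκ (2 ^ j - 1) (mem_Ici.2 ht₀) (mem_Ici.2 ht.le) h1.le
  simp only [← hp3] at hanti
  have hI : 0 ≤ ∫ x, w t x ^ 2 ^ (j + 1) := integral_nonneg fun x => hn _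
  have hsq : (∫ x, w t x ^ 2 ^ (j + 1)) ^ 2 ≤ (∫ x, w t₀ x ^ 2 ^ (j + 1)) ^ 2 := by gcongr
  have h3 : (3 * R) ^ Fintype.card ι * (∫ x, w t x ^ 2 ^ (j + 1)) ^ 2 ≤
      (3 * R) ^ Fintype.card ι * (∫ x, w t₀ x ^ 2 ^ (j + 1)) ^ 2 := by gcongr
  calc 4 * Real.pi ^ 2 * κ * R ^ 2 * ((∫ x, w t x ^ 2 ^ (j + 2)) -
        (3 * R) ^ Fintype.card ι * (∫ x, w t₀ x ^ 2 ^ (j + 1)) ^ 2)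
      ≤ 4 * Real.pi ^ 2 * κ * R ^ 2 * ((∫ x, w t x ^ 2 ^ (j + 2)) -
        (3 * R) ^ Fintype.card ι * (∫ x, w t x ^ 2 ^ (j + 1)) ^ 2) := by gcongr
    _ = κ * (4 * Real.pi ^ 2 * R ^ 2 * ((∫ x, w t x ^ 2 ^ (j + 2)) -
        (3 * R) ^ Fintype.card ι * (∫ x, w t x ^ 2 ^ (j + 1)) ^ 2)) := by ring
    _ ≤ _ := mul_le_mul_of_nonneg_left hN hκ.le

end IsDissipative

/-- Smoothing of dissipative flows from `L²` to `L^∞` in unit time. -/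
theorem exists_forall_isDissipative_sq_le (ι : Type*) [Fintype ι] [DecidableEq ι] {κ : ℝ}
    (hκ : 0 < κ) : ∃ Q : ℝ, 0 < Q ∧ ∀ w : ℝ → UnitAddTorus ι → ℝ, IsDissipative κ w →
      ∀ t, 0 ≤ t → ∀ x, w (t + 1) x ^ 2 ≤ Q * ∫ x, w t x ^ 2 := by
  obtain ⟨e, he⟩ := exists_nat_ge (4 * Real.pi ^ 2 * κ)
  set d := Fintype.card ι with hd
  set A : ℝ := (d + 1 + e) / (4 * Real.pi ^ 2 * κ) with hA
  have hd0 : (0 : ℝ) ≤ d := Nat.cast_nonneg d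
  have he0 : (0 : ℝ) ≤ e := Nat.cast_nonneg e
  have hA1 : 1 ≤ A := by
    rw [hA, le_div_iff₀ (by positivity)]
    linarith
  set a : ℝ := (d + 1 + e) * (9 * A) ^ d * 2 ^ d with ha
  have ha1 : 1 ≤ a := by
    refine one_le_mul_of_one_le_of_one_le (one_le_mul_of_one_le_of_one_le (by linarith)
      (one_le_pow₀ (by linarith))) (one_le_pow₀ one_le_two)
  have hb1 : (1 : ℝ) ≤ 2 ^ d := one_le_pow₀ one_le_two
  refine ⟨a * 2 ^ d, by positivity, fun w hw t ht x => ?_⟩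
  have hn : ∀ (j : ℕ) (r : ℝ), 0 ≤ r ^ 2 ^ (j + 1) := fun j r => by
    rw [pow_succ', pow_mul]; positivity
  -- Times increasing from $t$ towards $t+1$. The step $2^{-(j+1)}$ costs a factor $2^{(j+1)d}$ in
  -- the smoothing bound, hence the $2^d$ in $a$ and the ratio $b=2^d$.
  let s : ℕ → ℝ := fun j => t + (1 - (1 / 2) ^ j)
  have hs0 : ∀ j, 0 ≤ s j := fun j => by
    have : ((1 : ℝ) / 2) ^ j ≤ 1 := pow_le_one₀ (by norm_num) (by norm_num)
    simp only [s]; linarith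
  have hs1 : ∀ j, s (j + 1) = s j + (1 / 2) ^ (j + 1) := fun j => by
    simp only [s, pow_succ]; ring
  have hstep := le_pow_of_le_mul_sq (y := fun j => ∫ x, w (s j) x ^ 2 ^ (j + 1)) ha1 hb1
    (fun j => integral_nonneg fun x => hn j _) (fun j => by
      have h1 := hw.moment_le_mul_sq hκ he j (hs0 j) (τ := (1 / 2) ^ (j + 1)) (by positivity)
        (pow_le_one₀ (by norm_num) (by norm_num))
      rw [← hs1, ← hd, ← hA, one_div, inv_pow, inv_pow, ← div_eq_inv_mul,
        div_le_iff₀ (by positivity)] at h1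
      refine h1.trans (le_of_eq ?_)
      have h2 : ((2 : ℝ) ^ (j + 1)) ^ d = 2 ^ d * (2 ^ d) ^ j := by
        rw [← pow_mul, ← pow_mul, ← pow_add]
        congr 1
        ring
      rw [ha, h2]
      ring)
  refine sq_le_of_integral_pow_le (hw.isRegularFlow.continuous (by linarith)) (fun j => ?_) x
  have h1 := hstep j
  simp only [s, pow_zero, sub_self, add_zero, zero_add, pow_one] at h1
  refine le_trans ?_ h1
  have hp3 : 2 ^ (j + 1) = 2 * (2 ^ j - 1) + 2 := by
    have : 2 ^ (j + 1) = 2 * 2 ^ j := by ring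
    have := Nat.one_le_two_pow (n := j)
    omega
  -- Monotonicity carries each bound from its own time $s_j$ to the common time $t+1$.
  have hanti := hw.antitoneOn_moment hκ (2 ^ j - 1) (mem_Ici.2 (hs0 j))
    (mem_Ici.2 (by linarith : 0 ≤ t + 1)) (by
      have : (0 : ℝ) ≤ (1 / 2) ^ j := by positivity
      simp only [s]; linarith)
  simp only [← hp3] at hanti
  exact hanti

end Smoothing

/-! ### Application to the marginal and conclusion. -/

theorem IsSolution.isDissipative {m k : ℕ} {a : Algorithm} {β : ℝ}
    {F : UnitAddTorus (Fin m ⊕ Fin k) → Fin m ⊕ Fin k → ℝ}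
    {π : ℝ → UnitAddTorus (Fin m ⊕ Fin k) → ℝ} {B : ℝ → UnitAddTorus (Fin m) → Fin m → ℝ}
    (h : IsSolution a β F π B) (hβ : 0 < β) (hF : Continuous F) :
    IsDissipative (2 * β⁻¹) (fun t x => marginal (π t) x - 1) where
  isRegularFlow := h.isRegularFlow.marginal.comp (g := fun r => r - 1) (by fun_prop)
  integral_eq_zero t ht := by
    rw [integral_sub (integrable_of_continuous (h.isRegularFlow.marginal.continuous ht))
      (integrable_const _), h.integral_marginal ht]
    simp
  hasDerivAt p t ht := h.hasDerivAt_integral_pow hβ hF p ht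

theorem eLpNorm_two_eq_sqrt {ι : Type*} [Fintype ι] {f : UnitAddTorus ι → ℝ} (hf : Continuous f) :
    eLpNorm f 2 volume = ENNReal.ofReal (√(∫ x, f x ^ 2)) := by
  rw [(memLp_of_continuous hf 2).eLpNorm_eq_integral_rpow_norm two_ne_zero ENNReal.ofNat_ne_top,
    Real.sqrt_eq_rpow]
  simp

end

end AdaptiveBiasing

theorem mainTheorem7 (m : ℕ) (hm : 1 ≤ m) (β : ℝ) (hβ : 0 < β) :
    ∃ C : ℝ, 0 < C ∧
      ∀ (k : ℕ) (a : AdaptiveBiasing.Algorithm)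
        (F : UnitAddTorus (Fin m ⊕ Fin k) → Fin m ⊕ Fin k → ℝ)
        (π : ℝ → UnitAddTorus (Fin m ⊕ Fin k) → ℝ)
        (B : ℝ → UnitAddTorus (Fin m) → Fin m → ℝ),
        AdaptiveBiasing.TorusContDiff 1 F →
        AdaptiveBiasing.TorusContDiff ∞ (π 0) →
        (∀ x, 0 < AdaptiveBiasing.marginal (π 0) x) →
        AdaptiveBiasing.IsSolution a β F π B →
        ∀ t : ℝ, 1 ≤ t →
          eLpNorm (fun x => AdaptiveBiasing.marginal (π t) x - 1) ⊤ volume ≤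
            ENNReal.ofReal (C * Real.exp (-(4 * β⁻¹ * Real.pi ^ 2 * t))) *
              eLpNorm (fun x => AdaptiveBiasing.marginal (π 0) x - 1) 2 volume := by
  have hκ : 0 < 2 * β⁻¹ := by positivity
  obtain ⟨Q, hQ, hsup⟩ := AdaptiveBiasing.exists_forall_isDissipative_sq_le (Fin m) hκ
  -- The exponential factor pays for the unit of time spent on smoothing.
  refine ⟨√Q * Real.exp (4 * β⁻¹ * Real.pi ^ 2), by positivity, ?_⟩
  intro k a F π B hF _ _ hsol t ht
  have hw := hsol.isDissipative hβ hF.continuous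
  have ht0 : 0 ≤ t - 1 := by linarith
  set c := 4 * β⁻¹ * Real.pi ^ 2 with hc
  set I := ∫ x, (AdaptiveBiasing.marginal (π 0) x - 1) ^ 2 with hI
  have h2 := hw.integral_sq_le_exp hκ ht0
  have hpt : ∀ x, ‖AdaptiveBiasing.marginal (π t) x - 1‖ ≤
      √Q * Real.exp c * Real.exp (-(c * t)) * √I := by
    intro x
    have h1 := hsup _ hw (t - 1) ht0 x
    rw [sub_add_cancel] at h1
    rw [Real.norm_eq_abs]
    refine Real.abs_le_sqrt (h1.trans (mul_le_mul_of_nonneg_left h2 hQ.le)) |>.trans (le_of_eq ?_)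
    have he : Real.exp (-(4 * Real.pi ^ 2 * (2 * β⁻¹) * (t - 1))) =
        (Real.exp c * Real.exp (-(c * t))) ^ 2 := by
      rw [← Real.exp_add, ← Real.exp_nat_mul]
      congr 1
      rw [hc]; push_cast; ring
    rw [Real.sqrt_mul hQ.le, he, Real.sqrt_mul (sq_nonneg _), Real.sqrt_sq (by positivity)]
    ring
  rw [AdaptiveBiasing.eLpNorm_two_eq_sqrt (hw.isRegularFlow.continuous le_rfl),
    ← ENNReal.ofReal_mul (by positivity), eLpNorm_exponent_top]
  exact eLpNormEssSup_le_of_ae_bound (Filter.Eventually.of_forall hpt)
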